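/- \textbf{Setting.} Let $\Omega\subset\mathbb R^2$ be a simply connected bounded polygonal domain (it lies on one side of its boundary, and its boundary consists of disjoint simple closed polygons). A regular triangulation of $\Omega$ is a finite set of nondegenerate closed triangles covering $\overline\Omega$, two distinct ones of which share nothing, a common vertex, or a common edge. Let $\mathcal T_0$ be a regular triangulation of $\Omega$, each triangle being given a newest vertex; the opposite edge is its refinement edge. Newest vertex bisection of a triangle joins its newest vertex to the midpoint of its refinement edge, and this midpoint is the newest vertex of the two children. Let $\hat{\mathcal T}$ be a regular triangulation of $\Omega$ obtained from $\mathcal T_0$ by finitely many successive newest vertex bisections. $\mathcal V(\cdot)$ denotes the set of vertices of a triangulation and $\mathcal V_0(\hat{\mathcal T})=\mathcal V(\hat{\mathcal T})\cap\Omega$ the set of internal vertices. Each $x_e\in\mathcal V_0(\hat{\mathcal T})\setminus\mathcal V(\mathcal T_0)$ is the midpoint of an edge $e$ that is bisected in the refinement from $\mathcal T_0$ to $\hat{\mathcal T}$. Let $t_e$ be a unit tangential vector of $e$ (either orientation) and $n_e=t_e^\perp$ the rotation of $t_e$ by $90^\circ$, and let $\omega_{x_e}^{\pm}$ be the union of all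 $K\in\hat{\mathcal T}$ with $x_e\in K$ and $\pm(\operatorname{mid}(K)-x_e)\cdot n_e>0$, where $\operatorname{mid}(K)$ is the barycenter. Let $k\ge 3$ be an integer, let $\mathbb S$ be the space of symmetric $2\times2$ real matrices, and let $P_k(K;X)$ be the space of $X$-valued polynomials of total degree at most $k$ on $K$. For $K\in\hat{\mathcal T}$ with vertices $x_1,x_2,x_3$ and barycentric coordinates $\lambda_1,\lambda_2,\lambda_3$ put $$\Sigma_{k,b}(K)=\sum_{1\le i<j\le3}\lambda_i\lambda_jP_{k-2}(K;\mathbb R)\,(x_j-x_i)(x_j-x_i)^T,$$ and let $$\Sigma(\hat{\mathcal T})=\{\sigma\in H(\operatorname{div},\Omega;\mathbb S):\ \sigma=\sigma_c+\sigma_b,\ \sigma_c\in H^1(\Omega;\mathbb S),\ \sigma_c|_K\in P_k(K;\mathbb S),\ \sigma_b|_K\in\Sigma_{k,b}(K)\ \text{for all }K\in\hat{\mathcal T}\}.$$ For $x_e\in\mathcal V_0(\hat{\mathcal T})\setminus\mathcal V(\mathcal T_0)$ let $\varphi_{x_e}$ be the nodal basis function at $x_e$ of the scalar Lagrange element of order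 $k$ on $\hat{\mathcal T}$, and let $\varphi_{x_e}^{\pm}$ equal $\varphi_{x_e}$ on $\omega_{x_e}^{\pm}$ and $0$ elsewhere. The extended stress space is $$\widetilde{\Sigma(\hat{\mathcal T})}=\Sigma(\hat{\mathcal T})+\operatorname{span}\{\varphi_{x_e}^+t_et_e^T,\ \varphi_{x_e}^-t_et_e^T:\ x_e\in\mathcal V_0(\hat{\mathcal T})\setminus\mathcal V(\mathcal T_0)\}.$$ Let $S^{k+2}(\hat{\mathcal T})$ be the space of all $\phi\in L^2(\Omega)$ with $\phi|_K\in P_{k+2}(K;\mathbb R)$ for all $K\in\hat{\mathcal T}$ such that: $\phi$ and $\nabla\phi$ are continuous at all vertices of $\hat{\mathcal T}$; $\nabla\phi$ is continuous across all interior edges; $\nabla^2\phi$ is continuous at each vertex in $\mathcal V(\mathcal T_0)$ and at each boundary vertex in $\mathcal V(\hat{\mathcal T})\setminus\mathcal V_0(\hat{\mathcal T})$; and, at each $x_e\in\mathcal V_0(\hat{\mathcal T})\setminus\mathcal V(\mathcal T_0)$, $n_e^T\nabla^2\phi\,t_e$ and $t_e^T\nabla^2\phi\,t_e$ are continuous,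 while $n_e^T\nabla^2\phi\,n_e$ is continuous within $\omega_{x_e}^+$ and within $\omega_{x_e}^-$ (but may differ between the two). Continuity of an elementwise quantity at a vertex means that the polynomials on all triangles of $\hat{\mathcal T}$ with that vertex (and contained in the indicated patch, if any) give the same value there. For scalar $\phi$ let $\mathbf{Curl}\,\phi=(-\partial\phi/\partial x_2,\ \partial\phi/\partial x_1)$; for $v=(v_1,v_2)^T$ let $\mathbf{Curl}\,v$ be the matrix with rows $(-\partial v_i/\partial x_2,\ \partial v_i/\partial x_1)$, $i=1,2$; and let $\mathbf{CurlCurl}\,\phi=\mathbf{Curl}(\mathbf{Curl}\,\phi)$. All derivatives, and the row-wise divergence, are weak derivatives in $L^2(\Omega)$. \textbf{Lemma (discrete Helmholtz decomposition).} For every $\tau\in\widetilde{\Sigma(\hat{\mathcal T})}$ with $\operatorname{div}\tau=0$ there exists $\phi\in S^{k+2}(\hat{\mathcal T})$ such that $\tau=\mathbf{CurlCurl}\,\phi$. -/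

import Mathlib

open MeasureTheory
open scoped ContDiff Pointwise

namespace Helmholtz

/-- The Euclidean plane. -/
abbrev Plane := EuclideanSpace ℝ (Fin 2)

/-! ### Polygonal domains -/

/-- A bounded polygonal domain: a bounded, connected, open set lying on one side of its boundary,
the boundary being a finite disjoint union of simple closed polygons. The latter is encoded by a
finite set `B` of segments (given by their two endpoints) that meet only in common endpoints and
such that each endpoint belongs to exactly two of them. -/
structure IsPolygonalDomain (Ω : Set Plane) : Prop where
  isOpen : IsOpen Ω
  isConnected : IsConnected Ω
  isBounded : Bornology.IsBounded Ω
  one_sided : interior (closure Ω) = Ω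
  boundary : ∃ B : Set (Set Plane), B.Finite ∧ (∀ e ∈ B, e.ncard = 2) ∧
    (∀ e ∈ B, ∀ e' ∈ B, convexHull ℝ e ∩ convexHull ℝ e' = convexHull ℝ (e ∩ e')) ∧
    (∀ e ∈ B, ∀ p ∈ e, {e' ∈ B | p ∈ e'}.ncard = 2) ∧
    frontier Ω = ⋃ e ∈ B, convexHull ℝ e

/-! ### Triangles and newest vertex bisection -/

/-- A (nondegenerate) triangle with an ordering of its vertices. The vertex number `0` is the
newest vertex, the opposite edge, with endpoints number `1` and `2`, is the refinement edge. -/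
abbrev Triangle := Affine.Triangle ℝ Plane

namespace Triangle

/-- The set of the three vertices. -/
def verts (K : Triangle) : Set Plane := Set.range K.points

/-- The closed triangle as a set of points. -/
def carrier (K : Triangle) : Set Plane := convexHull ℝ K.verts

/-- The barycenter of the triangle. -/
noncomputable def mid (K : Triangle) : Plane := (1 / 3 : ℝ) • ∑ i, K.points i

/-- The vertices of a triangle form an affine basis of the plane. -/
def basis (K : Triangle) : AffineBasis (Fin 3) ℝ Plane where
  toFun := K.points
  ind' := K.independent
  tot' := by
    rw [K.independent.affineSpan_eq_top_iff_card_eq_finrank_add_one]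
    simp

/-- The barycentric coordinate with respect to the `i`-th vertex. -/
noncomputable def bary (K : Triangle) (i : Fin 3) (y : Plane) : ℝ := K.basis.coord i y

theorem child_independent {a b c : Plane} (h : AffineIndependent ℝ ![a, b, c]) :
    AffineIndependent ℝ ![midpoint ℝ b c, a, b] := by
  rw [affineIndependent_iff_of_fintype] at h ⊢
  intro w hw hv
  rw [Finset.weightedVSub_eq_linear_combination Finset.univ hw] at hv
  rw [Fin.sum_univ_three] at hw hv
  have hw' : ∑ i, (![w 1, w 0 / 2 + w 2, w 0 / 2] : Fin 3 → ℝ) i = 0 := by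
    rw [Fin.sum_univ_three]
    simp
    linarith
  have key := h ![w 1, w 0 / 2 + w 2, w 0 / 2] hw' (by
    rw [Finset.weightedVSub_eq_linear_combination Finset.univ hw', Fin.sum_univ_three]
    simp only [Matrix.cons_val_zero, Matrix.cons_val_one, Matrix.cons_val] at hv ⊢
    rw [← hv, midpoint_eq_smul_add]
    simp only [invOf_eq_inv]
    module)
  have h0 := key 0
  have h1 := key 1
  have h2 := key 2
  simp at h0 h1 h2
  intro i
  fin_cases i <;> simp <;> linarith

theorem points_swap_independent (K : Triangle) :
    AffineIndependent ℝ ![K.points 0, K.points 1, K.points 2] ∧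
      AffineIndependent ℝ ![K.points 0, K.points 2, K.points 1] := by
  have h1 : ![K.points 0, K.points 1, K.points 2] = K.points := by
    funext i; fin_cases i <;> rfl
  have h2 : ![K.points 0, K.points 2, K.points 1] = K.points ∘ Equiv.swap (1 : Fin 3) 2 := by
    funext i; fin_cases i <;> rfl
  rw [h1, h2]
  exact ⟨K.independent, K.independent.comp_embedding (Equiv.swap (1 : Fin 3) 2).toEmbedding⟩

/-- The two triangles into which `K` is bisected by joining its newest vertex to the midpoint of
the refinement edge; this midpoint is the newest vertex of both. -/
noncomputable def child₁ (K : Triangle) : Triangle where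
  points := ![midpoint ℝ (K.points 1) (K.points 2), K.points 0, K.points 1]
  independent := child_independent K.points_swap_independent.1

/-- The second child of `K`; see `child₁`. -/
noncomputable def child₂ (K : Triangle) : Triangle where
  points := ![midpoint ℝ (K.points 2) (K.points 1), K.points 0, K.points 2]
  independent := child_independent K.points_swap_independent.2

end Triangle

/-- The vertices of a mesh. -/
def vertices (T : Set Triangle) : Set Plane := ⋃ K ∈ T, K.verts

/-- `T` is a regular (conforming) triangulation of `Ω`: finitely many triangles covering the
closure of `Ω`, two distinct ones sharing nothing, a common vertex, or a common edge. -/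
structure IsRegularTriangulation (Ω : Set Plane) (T : Set Triangle) : Prop where
  finite : T.Finite
  cover : ⋃ K ∈ T, K.carrier = closure Ω
  conforming : ∀ K ∈ T, ∀ K' ∈ T, K ≠ K' →
    K.verts ≠ K'.verts ∧ K.carrier ∩ K'.carrier = convexHull ℝ (K.verts ∩ K'.verts)

/-- Replace the triangle `K` by its two children. -/
def bisect (T : Set Triangle) (K : Triangle) : Set Triangle :=
  (T \ {K}) ∪ {K.child₁, K.child₂}

/-- `T'` is obtained from `T` by finitely many successive newest vertex bisections of single
triangles (the intermediate partitions may have hanging nodes). -/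
def Refines : Set Triangle → Set Triangle → Prop :=
  Relation.ReflTransGen fun T T' => ∃ K ∈ T, T' = bisect T K

/-- The set of all regular triangulations of `Ω` obtained from `T₀` by newest vertex bisection. -/
def admissible (Ω : Set Plane) (T₀ : Set Triangle) : Set (Set Triangle) :=
  {T | Refines T₀ T ∧ IsRegularTriangulation Ω T}

/-- In the refinement from `T₀` to `T`, some triangle with refinement edge `ab` was bisected, and
`x` is the midpoint of `ab`. -/
def IsBisectedEdge (T₀ T : Set Triangle) (x a b : Plane) : Prop :=
  x = midpoint ℝ a b ∧ ∃ T₁ K, Refines T₀ T₁ ∧ K ∈ T₁ ∧ Refines (bisect T₁ K) T ∧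
    ((a = K.points 1 ∧ b = K.points 2) ∨ (a = K.points 2 ∧ b = K.points 1))

/-- The internal vertices of `T` that are not vertices of `T₀`. -/
def newInternalVertices (Ω : Set Plane) (T₀ T : Set Triangle) : Set Plane :=
  (vertices T ∩ Ω) \ vertices T₀

/-- `edge` assigns to each new internal vertex `x` of `T` an (oriented) edge, bisected in the
refinement from `T₀` to `T`, whose midpoint is `x`. -/
def IsEdgeChoice (Ω : Set Plane) (T₀ T : Set Triangle) (edge : Plane → Plane × Plane) : Prop :=
  ∀ x ∈ newInternalVertices Ω T₀ T, IsBisectedEdge T₀ T x (edge x).1 (edge x).2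

/-- The unit tangential vector of the edge from `e.1` to `e.2`. -/
noncomputable def tangent (e : Plane × Plane) : Plane := ‖e.2 - e.1‖⁻¹ • (e.2 - e.1)

/-- The unit normal vector of the edge from `e.1` to `e.2`: the rotated tangential vector. -/
noncomputable def normal (e : Plane × Plane) : Plane := !₂[-(tangent e 1), tangent e 0]

/-- The triangle `K` contains `x` and its barycenter lies on the side of `x` to which `n` points. -/
def OnSide (x n : Plane) (K : Triangle) : Prop := x ∈ K.carrier ∧ 0 < inner ℝ (K.mid - x) n

/-- The patch `ω⁺` at `x` for the normal vector `n`; the patch `ω⁻` is `patch T x (-n)`. -/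
def patch (T : Set Triangle) (x n : Plane) : Set Plane := ⋃ K ∈ {K ∈ T | OnSide x n K}, K.carrier

/-! ### Weak derivatives -/

/-- Test functions: the smooth functions with compact support in `Ω`. -/
def IsTest (Ω : Set Plane) (ψ : Plane → ℝ) : Prop :=
  ContDiff ℝ ∞ ψ ∧ HasCompactSupport ψ ∧ tsupport ψ ⊆ Ω

/-- The classical partial derivative of a test function. -/
noncomputable def partialDeriv (i : Fin 2) (ψ : Plane → ℝ) (x : Plane) : ℝ :=
  fderiv ℝ ψ x (EuclideanSpace.single i 1)

/-- Square-integrability on `Ω`. -/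
def IsL2 (Ω : Set Plane) (u : Plane → ℝ) : Prop := MemLp u 2 (volume.restrict Ω)

/-- `u` is in `L²(Ω)` and has the weak partial derivative `∂u/∂xᵢ = g` in `L²(Ω)`. -/
def HasWeakPartial (Ω : Set Plane) (i : Fin 2) (u g : Plane → ℝ) : Prop :=
  IsL2 Ω u ∧ IsL2 Ω g ∧ ∀ ψ, IsTest Ω ψ →
    ∫ x in Ω, u x * partialDeriv i ψ x = -∫ x in Ω, g x * ψ x

/-- The space `H¹(Ω)`. -/
def H1 (Ω : Set Plane) : Set (Plane → ℝ) := {u | IsL2 Ω u ∧ ∀ i, ∃ g, HasWeakPartial Ω i u g}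

/-- Matrix fields on the plane; as elements of function spaces they matter up to null sets. -/
abbrev MatrixField := Plane → Matrix (Fin 2) (Fin 2) ℝ

/-- `τ` is in `L²(Ω)` and has the weak (row-wise) divergence `f` in `L²(Ω)`. -/
def HasWeakDiv (Ω : Set Plane) (τ : MatrixField) (f : Plane → Fin 2 → ℝ) : Prop :=
  (∀ i j, IsL2 Ω fun x => τ x i j) ∧ (∀ i, IsL2 Ω fun x => f x i) ∧
    ∀ i, ∀ ψ, IsTest Ω ψ →
      ∫ x in Ω, ∑ j, τ x i j * partialDeriv j ψ x = -∫ x in Ω, f x i * ψ x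

/-- The space `H(div, Ω; 𝕊)` of symmetric matrix fields. -/
def Hdiv (Ω : Set Plane) : Set MatrixField :=
  {τ | (∀ᵐ x ∂volume.restrict Ω, (τ x).IsSymm) ∧ ∃ f, HasWeakDiv Ω τ f}

/-- The space `H¹(Ω; 𝕊)` of symmetric matrix fields. -/
def H1Sym (Ω : Set Plane) : Set MatrixField :=
  {τ | (∀ᵐ x ∂volume.restrict Ω, (τ x).IsSymm) ∧ ∀ i j, (fun x => τ x i j) ∈ H1 Ω}

/-- `v = Curl φ = (-∂φ/∂x₂, ∂φ/∂x₁)` for a scalar function `φ ∈ H¹(Ω)`. -/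
def IsCurl (Ω : Set Plane) (φ : Plane → ℝ) (v : Plane → Fin 2 → ℝ) : Prop :=
  HasWeakPartial Ω 1 φ (fun x => -v x 0) ∧ HasWeakPartial Ω 0 φ (fun x => v x 1)

/-- `τ = Curl v`, the matrix field with rows `(-∂vᵢ/∂x₂, ∂vᵢ/∂x₁)`, for `v ∈ H¹(Ω; ℝ²)`. -/
def IsVecCurl (Ω : Set Plane) (v : Plane → Fin 2 → ℝ) (τ : MatrixField) : Prop :=
  ∀ i, IsCurl Ω (fun x => v x i) (τ · i)

/-- `τ = CurlCurl φ`. -/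
def IsCurlCurl (Ω : Set Plane) (φ : Plane → ℝ) (τ : MatrixField) : Prop :=
  ∃ v, IsCurl Ω φ v ∧ IsVecCurl Ω v τ

/-! ### Polynomials -/

/-- Polynomials in the two coordinates. -/
abbrev Poly := MvPolynomial (Fin 2) ℝ

/-- The value of a polynomial at a point. -/
noncomputable def val (p : Poly) (x : Plane) : ℝ := MvPolynomial.eval (fun i => x i) p

/-- The Hessian matrix of a polynomial at a point. -/
noncomputable def hess (p : Poly) (x : Plane) : Matrix (Fin 2) (Fin 2) ℝ :=
  Matrix.of fun i j => val (MvPolynomial.pderiv i (MvPolynomial.pderiv j p)) x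

/-- The value `uᵀ M w`. -/
def quad (u : Plane) (M : Matrix (Fin 2) (Fin 2) ℝ) (w : Plane) : ℝ :=
  ∑ i, ∑ j, u i * M i j * w j

/-- The matrix `t tᵀ`. -/
def dyad (t : Plane) : Matrix (Fin 2) (Fin 2) ℝ := Matrix.of fun i j => t i * t j

/-! ### The discrete stress spaces -/

/-- `τ` restricted to `K` is in `P_k(K; 𝕊)`. -/
def IsSymPolyOn (k : ℕ) (K : Triangle) (τ : MatrixField) : Prop :=
  ∃ P : Matrix (Fin 2) (Fin 2) Poly, P.IsSymm ∧ (∀ i j, (P i j).totalDegree ≤ k) ∧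
    ∀ᵐ x ∂volume.restrict K.carrier, τ x = Matrix.of fun i j => val (P i j) x

/-- `τ` restricted to `K` is in the bubble space
`Σ_{k,b}(K) = ∑_{i<j} λᵢ λⱼ P_{k-2}(K) (xⱼ - xᵢ)(xⱼ - xᵢ)ᵀ` (for `2 ≤ k`). -/
def IsBubbleOn (k : ℕ) (K : Triangle) (τ : MatrixField) : Prop :=
  ∃ q : Fin 3 → Fin 3 → Poly, (∀ i j, (q i j).totalDegree ≤ k - 2) ∧
    ∀ᵐ x ∂volume.restrict K.carrier,
      τ x = ∑ i, ∑ j ∈ Finset.Ioi i,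
        (K.bary i x * K.bary j x * val (q i j) x) • dyad (K.points j - K.points i)

/-- The space `Σ(T)` for the polynomial degree `k`. -/
def stressSpace (Ω : Set Plane) (k : ℕ) (T : Set Triangle) : Set MatrixField :=
  {σ | σ ∈ Hdiv Ω ∧ ∃ σc σb : MatrixField, (∀ᵐ x ∂volume.restrict Ω, σ x = σc x + σb x) ∧
    σc ∈ H1Sym Ω ∧ ∀ K ∈ T, IsSymPolyOn k K σc ∧ IsBubbleOn k K σb}

/-- The one-dimensional Lagrange polynomial `∏_{j<k} (k s - j) / (j + 1)`: it is `1` at `s = 1`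
and vanishes at `s = 0, 1/k, …, (k-1)/k`. -/
noncomputable def lagrange (k : ℕ) (s : ℝ) : ℝ :=
  ∏ j ∈ Finset.range k, ((k : ℝ) * s - j) / (j + 1)

open Classical in
/-- The nodal basis function at the vertex `x` of the scalar Lagrange element of order `k`: it is
`lagrange k` of the barycentric coordinate with respect to `x` on the triangles with vertex `x`,
and zero elsewhere. -/
noncomputable def nodalBasis (k : ℕ) (T : Set Triangle) (x y : Plane) : ℝ :=
  if h : ∃ Ki : Triangle × Fin 3, Ki.1 ∈ T ∧ Ki.1.points Ki.2 = x ∧ y ∈ Ki.1.carrier then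
    lagrange k (h.choose.1.bary h.choose.2 y)
  else 0

/-- The split pure tangential basis function at `x`: the field `φ_x t tᵀ` on the patch determined
by `n`, and zero elsewhere. -/
noncomputable def splitBasis (k : ℕ) (T : Set Triangle) (x t n : Plane) : MatrixField :=
  (patch T x n).indicator fun y => nodalBasis k T x y • dyad t

/-- The space `E(T)` spanned by the split basis functions at the new internal vertices. -/
noncomputable def enrichment (Ω : Set Plane) (k : ℕ) (T₀ T : Set Triangle)
    (edge : Plane → Plane × Plane) : Submodule ℝ MatrixField :=
  Submodule.span ℝ {η | ∃ x ∈ newInternalVertices Ω T₀ T,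
    η = splitBasis k T x (tangent (edge x)) (normal (edge x)) ∨
    η = splitBasis k T x (tangent (edge x)) (-normal (edge x))}

/-- The extended stress space `Σ(T) + E(T)`. -/
def extendedStressSpace (Ω : Set Plane) (k : ℕ) (T₀ T : Set Triangle)
    (edge : Plane → Plane × Plane) : Set MatrixField :=
  stressSpace Ω k T + (enrichment Ω k T₀ T edge : Set MatrixField)

/-! ### The modified Argyris space -/

/-- The quantity `F K` attached to the triangles `K` of `T` takes one value on all triangles of
`T` with vertex `x` that satisfy `C`. -/
def AgreeAt {α : Type*} (T : Set Triangle) (x : Plane) (C : Triangle → Prop)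
    (F : Triangle → α) : Prop :=
  ∀ K ∈ T, ∀ K' ∈ T, x ∈ K.verts → x ∈ K'.verts → C K → C K' → F K = F K'

/-- The `H²`-conforming space `S^m(T)` of piecewise polynomials of degree at most `m`; `p K` is the
polynomial that `φ` equals on `K`. -/
def argyrisSpace (Ω : Set Plane) (m : ℕ) (T₀ T : Set Triangle)
    (edge : Plane → Plane × Plane) : Set (Plane → ℝ) :=
  {φ | IsL2 Ω φ ∧ ∃ p : Triangle → Poly,
    (∀ K ∈ T, (p K).totalDegree ≤ m ∧ ∀ᵐ x ∂volume.restrict K.carrier, φ x = val (p K) x) ∧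
    -- values and gradients are continuous at all vertices
    (∀ x ∈ vertices T, AgreeAt T x (fun _ => True) fun K => val (p K) x) ∧
    (∀ x ∈ vertices T, ∀ i,
      AgreeAt T x (fun _ => True) fun K => val (MvPolynomial.pderiv i (p K)) x) ∧
    -- gradients are continuous across all interior edges
    (∀ K ∈ T, ∀ K' ∈ T, K ≠ K' → ∀ a ∈ K.verts ∩ K'.verts, ∀ b ∈ K.verts ∩ K'.verts, a ≠ b →
      ∀ y ∈ segment ℝ a b, ∀ i,
        val (MvPolynomial.pderiv i (p K)) y = val (MvPolynomial.pderiv i (p K')) y) ∧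
    -- Hessians are continuous at the initial vertices and at the boundary vertices
    (∀ x ∈ vertices T, x ∈ vertices T₀ ∨ x ∉ Ω →
      AgreeAt T x (fun _ => True) fun K => hess (p K) x) ∧
    -- at a new internal vertex only the pure normal component may jump, and only across the edge
    (∀ x ∈ newInternalVertices Ω T₀ T,
      AgreeAt T x (fun _ => True)
        (fun K => quad (normal (edge x)) (hess (p K) x) (tangent (edge x))) ∧
      AgreeAt T x (fun _ => True)
        (fun K => quad (tangent (edge x)) (hess (p K) x) (tangent (edge x))) ∧
      AgreeAt T x (OnSide x (normal (edge x)))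
        (fun K => quad (normal (edge x)) (hess (p K) x) (normal (edge x))) ∧
      AgreeAt T x (OnSide x (-normal (edge x)))
        (fun K => quad (normal (edge x)) (hess (p K) x) (normal (edge x))))}

end Helmholtz

/-!
A divergence-free, symmetric, piecewise polynomial matrix field `τ` is the `CurlCurl` of a scalar
function: the rows of `τ`, rotated by a right angle, are weakly curl-free, hence gradients of the
components `v₀`, `v₁` of a vector field; by symmetry of `τ` the field `(v₁, -v₀)` is again weakly
curl-free, hence the gradient of some `φ`. Both steps are
`IsRegularTriangulation.exists_potential`, which rests on the following facts.

* The Poincaré lemma `exists_continuousOn_weakGrad`. On discs, mollified curl-free fields have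
  primitives by the classical lemma, and the Lipschitz bounds coming from the boundedness of the
  field allow a passage to the limit (`exists_lipschitzWith_weakGrad`). Local primitives differ by
  locally constant functions, so that the sheaf of primitives is a covering space of `Ω`, which has
  a global section because `Ω` is simply connected (`exists_glue_of_locally_const`).
* On each triangle the primitive of a polynomial field is a polynomial whose degree is larger by one
  (`exists_eq_val_of_weakGrad`).
* The polynomials on two triangles agree at every common point. For points in the domain this is
  the continuity of the primitive. For boundary points it follows because the polygonal domain is
  connected near each of its boundary points: the boundary is locally the union of two rays, with
  the domain on one side of it only (`IsPolygonalDomain.eventually_isPreconnected`,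
  `IsRegularTriangulation.val_eq_of_mem`).

This gives the degree of `φ` and the continuity of `φ` and its gradient. The conditions on the
Hessian of `φ` at the vertices are pointwise conditions on `τ`, as the Hessian is the conjugate of
`CurlCurl φ` by a rotation. They are verified in `exists_isStressPieces`: the `H¹` part of `τ` is
continuous at all vertices, the bubble part vanishes there, and the additional fields
`φ_x t tᵀ` on one side of an edge only contribute to the tangential-tangential component at `x`.
-/

namespace Helmholtz

open Filter Topology Set Metric
open scoped Convolution

/-! ### Mollification of functions with bounded weak gradient -/

/-- `φ_ε ∗ u`, written with the kernel as a test function in the integration variable. -/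
noncomputable def mollify (φ : ContDiffBump (0 : Plane)) (u : Plane → ℝ) (x : Plane) : ℝ :=
  ∫ y, u y * φ.normed volume (x - y)

theorem mollify_eq_convolution (φ : ContDiffBump (0 : Plane)) (u : Plane → ℝ) :
    mollify φ u = φ.normed volume ⋆[ContinuousLinearMap.lsmul ℝ ℝ, volume] u := by
  ext x
  rw [convolution_eq_swap]
  simp [mollify, mul_comm]

theorem isTest_kernel (φ : ContDiffBump (0 : Plane)) {x : Plane} {U : Set Plane}
    (h : closedBall x φ.rOut ⊆ U) : IsTest U fun y => φ.normed volume (x - y) := by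
  have hs : (fun y => φ.normed volume (x - y)).support ⊆ closedBall x φ.rOut := by
    intro y hy
    have : x - y ∈ Function.support (φ.normed volume) := hy
    rw [φ.support_normed_eq] at this
    rw [mem_closedBall, dist_comm, dist_eq_norm]
    simpa using (mem_ball_zero_iff.1 this).le
  have ht : tsupport (fun y => φ.normed volume (x - y)) ⊆ closedBall x φ.rOut :=
    closure_minimal hs isClosed_closedBall
  refine ⟨φ.contDiff_normed.comp (contDiff_const.sub contDiff_id), ?_, ht.trans h⟩
  exact (isCompact_closedBall x φ.rOut).of_isClosed_subset (isClosed_tsupport _) ht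

theorem contDiff_mollify (φ : ContDiffBump (0 : Plane)) {u : Plane → ℝ}
    (hu : LocallyIntegrable u) : ContDiff ℝ ∞ (mollify φ u) := by
  rw [mollify_eq_convolution]
  exact φ.hasCompactSupport_normed.contDiff_convolution_left _ φ.contDiff_normed hu

theorem integrable_mul_of_hasCompactSupport {u ψ : Plane → ℝ} (hu : LocallyIntegrable u)
    (hψ : Continuous ψ) (hc : HasCompactSupport ψ) : Integrable fun x => u x * ψ x := by
  simpa [mul_comm] using hu.integrable_smul_left_of_hasCompactSupport hψ hc

theorem IsTest.continuous_partialDeriv {U : Set Plane} {ψ : Plane → ℝ} (h : IsTest U ψ)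
    (i : Fin 2) : Continuous (partialDeriv i ψ) :=
  (h.1.continuous_fderiv (by simp)).clm_apply continuous_const

theorem tsupport_partialDeriv_subset (i : Fin 2) (ψ : Plane → ℝ) :
    tsupport (partialDeriv i ψ) ⊆ tsupport ψ :=
  tsupport_fderiv_apply_subset ℝ _

theorem IsTest.hasCompactSupport_partialDeriv {U : Set Plane} {ψ : Plane → ℝ} (h : IsTest U ψ)
    (i : Fin 2) : HasCompactSupport (partialDeriv i ψ) :=
  h.2.1.of_isClosed_subset (isClosed_tsupport _) (tsupport_partialDeriv_subset i ψ)

theorem IsTest.eq_zero {U : Set Plane} {ψ : Plane → ℝ} (h : IsTest U ψ) {x : Plane} (hx : x ∉ U) :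
    ψ x = 0 :=
  image_eq_zero_of_notMem_tsupport fun h' => hx (h.2.2 h')

theorem IsTest.partialDeriv_eq_zero {U : Set Plane} {ψ : Plane → ℝ} (h : IsTest U ψ) (i : Fin 2)
    {x : Plane} (hx : x ∉ U) : partialDeriv i ψ x = 0 :=
  image_eq_zero_of_notMem_tsupport fun h' =>
    hx (h.2.2 (tsupport_partialDeriv_subset i ψ h'))

theorem fderiv_mollify (φ : ContDiffBump (0 : Plane)) {u : Plane → ℝ}
    (hu : LocallyIntegrable u) (x : Plane) (i : Fin 2) :
    fderiv ℝ (mollify φ u) x (EuclideanSpace.single i 1) =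
      -∫ y, u y * partialDeriv i (fun z => φ.normed volume (x - z)) y := by
  rw [mollify_eq_convolution]
  have h1 : ContDiff ℝ 1 (φ.normed (volume : Measure Plane)) := φ.contDiff_normed
  rw [(φ.hasCompactSupport_normed.hasFDerivAt_convolution_left _ h1 hu x).fderiv,
    convolution_eq_swap]
  have hint : Integrable (fun t => ((ContinuousLinearMap.precompL Plane
      (ContinuousLinearMap.lsmul ℝ ℝ)) (fderiv ℝ (φ.normed volume) (x - t))) (u t)) := by
    have := (φ.hasCompactSupport_normed (μ := (volume : Measure Plane))).fderiv ℝ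
    have := this.convolutionExists_left (ContinuousLinearMap.precompL Plane
      (ContinuousLinearMap.lsmul ℝ ℝ)) (h1.continuous_fderiv one_ne_zero) hu x
    exact this.integrable_swap
  rw [ContinuousLinearMap.integral_apply hint, ← integral_neg]
  congr 1
  ext y
  have : HasFDerivAt (fun z => φ.normed volume (x - z))
      ((fderiv ℝ (φ.normed volume) (x - y)).comp (-ContinuousLinearMap.id ℝ Plane)) y := by
    have h2 : HasFDerivAt (fun z : Plane => x - z) (-ContinuousLinearMap.id ℝ Plane) y := by
      simpa using (hasFDerivAt_id y).const_sub x
    exact ((h1.differentiable one_ne_zero _).hasFDerivAt).comp y h2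
  rw [partialDeriv, this.fderiv]
  simp [ContinuousLinearMap.precompL_apply, mul_comm]

theorem abs_mollify_le (φ : ContDiffBump (0 : Plane)) {u : Plane → ℝ} {U : Set Plane} {M : ℝ}
    (hM : ∀ᵐ y, y ∈ U → |u y| ≤ M) {x : Plane} (h : closedBall x φ.rOut ⊆ U) :
    |mollify φ u x| ≤ M := by
  have hi : Integrable (fun y => M * φ.normed volume (x - y)) :=
    ((φ.integrable_normed (μ := (volume : Measure Plane))).comp_sub_left x).const_mul M
  calc |mollify φ u x| ≤ ∫ y, M * φ.normed volume (x - y) := by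
        rw [← Real.norm_eq_abs, mollify]
        refine norm_integral_le_of_norm_le hi ?_
        filter_upwards [hM] with y hy
        rw [norm_mul, Real.norm_eq_abs, Real.norm_of_nonneg (φ.nonneg_normed _)]
        by_cases hyU : y ∈ U
        · exact mul_le_mul_of_nonneg_right (hy hyU) (φ.nonneg_normed _)
        · simp [(isTest_kernel φ h).eq_zero hyU]
    _ = M := by
        rw [integral_const_mul, integral_sub_left_eq_self (φ.normed volume), φ.integral_normed,
          mul_one]

/-- A sequence of bump functions shrinking to the origin. -/
noncomputable def bumpSeq (n : ℕ) : ContDiffBump (0 : Plane) where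
  rIn := 1 / ((n : ℝ) + 1)
  rOut := 2 / ((n : ℝ) + 1)
  rIn_pos := by positivity
  rIn_lt_rOut := by gcongr; norm_num

theorem tendsto_bumpSeq_rOut : Tendsto (fun n => (bumpSeq n).rOut) atTop (𝓝 0) := by
  have := (tendsto_one_div_add_atTop_nhds_zero_nat (𝕜 := ℝ)).const_mul 2
  simpa [bumpSeq, div_eq_mul_inv] using this

theorem ae_tendsto_mollify {u : Plane → ℝ} (hu : LocallyIntegrable u) :
    ∀ᵐ x, Tendsto (fun n => mollify (bumpSeq n) u x) atTop (𝓝 (u x)) := by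
  simp_rw [mollify_eq_convolution]
  exact ContDiffBump.ae_convolution_tendsto_right_of_locallyIntegrable (K := 2)
    tendsto_bumpSeq_rOut (.of_forall fun n => by simp [bumpSeq, div_eq_mul_inv]) hu

/-- `g` is the weak gradient of `u` on `U`, in terms of integrals over the plane; no integrability
is included. -/
def WeakGrad (U : Set Plane) (u : Plane → ℝ) (g : Fin 2 → Plane → ℝ) : Prop :=
  ∀ i ψ, IsTest U ψ → ∫ x, u x * partialDeriv i ψ x = -∫ x, g i x * ψ x

/-- The vector field `g` is weakly curl-free on `U`. -/
def WeakClosed (U : Set Plane) (g : Fin 2 → Plane → ℝ) : Prop :=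
  ∀ ψ, IsTest U ψ → ∫ x, g 1 x * partialDeriv 0 ψ x = ∫ x, g 0 x * partialDeriv 1 ψ x

theorem clm_apply_eq (L : Plane →L[ℝ] ℝ) (w : Plane) :
    L w = w 0 * L (EuclideanSpace.single 0 1) + w 1 * L (EuclideanSpace.single 1 1) := by
  have hw : w = w 0 • EuclideanSpace.single 0 1 + w 1 • EuclideanSpace.single 1 1 := by
    ext i; fin_cases i <;> simp
  conv_lhs => rw [hw]
  rw [map_add, map_smul, map_smul]; rfl

theorem norm_clm_le_of_basis {L : Plane →L[ℝ] ℝ} {M : ℝ} (hM : 0 ≤ M)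
    (h : ∀ i : Fin 2, |L (EuclideanSpace.single i 1)| ≤ M) : ‖L‖ ≤ 2 * M := by
  refine L.opNorm_le_bound (by positivity) fun w => ?_
  have h0 := PiLp.norm_apply_le w 0
  have h1 := PiLp.norm_apply_le w 1
  rw [Real.norm_eq_abs] at h0 h1
  calc ‖L w‖ = |w 0 * L (EuclideanSpace.single 0 1) + w 1 * L (EuclideanSpace.single 1 1)| := by
        rw [Real.norm_eq_abs, clm_apply_eq]
    _ ≤ |w 0| * |L (EuclideanSpace.single 0 1)| + |w 1| * |L (EuclideanSpace.single 1 1)| := by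
        rw [← abs_mul, ← abs_mul]; exact abs_add_le _ _
    _ ≤ ‖w‖ * M + ‖w‖ * M := by gcongr <;> apply h
    _ = 2 * M * ‖w‖ := by ring

/-- The mollification of a function with bounded weak gradient is Lipschitz, away from
the boundary. -/
theorem dist_mollify_le {U V : Set Plane} (φ : ContDiffBump (0 : Plane)) (hV : Convex ℝ V)
    (hVU : ∀ x ∈ V, closedBall x φ.rOut ⊆ U) {u : Plane → ℝ} {g : Fin 2 → Plane → ℝ}
    (hu : LocallyIntegrable u) {M : ℝ} (hM : 0 ≤ M)
    (hgM : ∀ i, ∀ᵐ x, x ∈ U → |g i x| ≤ M) (h : WeakGrad U u g) {x y : Plane} (hx : x ∈ V)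
    (hy : y ∈ V) : |mollify φ u y - mollify φ u x| ≤ 2 * M * ‖y - x‖ := by
  refine hV.norm_image_sub_le_of_norm_fderiv_le (𝕜 := ℝ)
    (fun z _ => (contDiff_mollify φ hu).differentiable (by simp) z) (fun z hz => ?_) hx hy
  refine norm_clm_le_of_basis hM fun i => ?_
  rw [fderiv_mollify φ hu, h i _ (isTest_kernel φ (hVU z hz)), neg_neg]
  exact abs_mollify_le φ (hgM i) (hVU z hz)

/-- A locally integrable function with bounded weak gradient on a convex open set is Lipschitz:
this holds at Lebesgue points, by mollification. -/
theorem exists_lipschitzWith_of_weakGrad {U : Set Plane} (hU : IsOpen U) (hUc : Convex ℝ U)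
    {u : Plane → ℝ} {g : Fin 2 → Plane → ℝ} (hu : LocallyIntegrable u) {M : NNReal}
    (hgM : ∀ i, ∀ᵐ x, x ∈ U → |g i x| ≤ M) (h : WeakGrad U u g) :
    ∃ f : Plane → ℝ, LipschitzWith (2 * M) f ∧ ∀ᵐ x, x ∈ U → u x = f x := by
  set S := {x | x ∈ U ∧ Tendsto (fun n => mollify (bumpSeq n) u x) atTop (𝓝 (u x))}
  have hS : LipschitzOnWith (2 * M) u S := by
    refine LipschitzOnWith.of_dist_le_mul fun x hx y hy => ?_
    have hseg : segment ℝ x y ⊆ U := hUc.segment_subset hx.1 hy.1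
    have hcomp : IsCompact (segment ℝ x y) := by
      rw [segment_eq_image]
      exact isCompact_Icc.image (by fun_prop)
    obtain ⟨δ, hδ, hδU⟩ := hcomp.exists_cthickening_subset_open hU hseg
    have hev : ∀ᶠ n in atTop, (bumpSeq n).rOut < δ :=
      tendsto_bumpSeq_rOut.eventually (gt_mem_nhds hδ)
    have hlim := ((hx.2.sub hy.2)).abs
    rw [Real.dist_eq, dist_eq_norm]
    refine le_of_tendsto hlim ?_
    filter_upwards [hev] with n hn
    have := dist_mollify_le (bumpSeq n) (convex_segment x y) (U := U) (fun z hz => ?_) hu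
      M.2 hgM h (right_mem_segment ℝ x y) (left_mem_segment ℝ x y)
    · simpa using this
    · exact (closedBall_subset_closedBall hn.le).trans
        ((closedBall_subset_cthickening hz δ).trans hδU)
  obtain ⟨f, hf, hfS⟩ := hS.extend_real
  refine ⟨f, hf, ?_⟩
  filter_upwards [ae_tendsto_mollify hu] with x hx hxU
  exact hfS ⟨hxU, hx⟩

/-! ### Local primitives of curl-free fields -/

/-- The linear form with the given components. -/
noncomputable def formOf (a : Fin 2 → ℝ) : Plane →L[ℝ] ℝ :=
  a 0 • EuclideanSpace.proj 0 + a 1 • EuclideanSpace.proj 1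

theorem formOf_single (a : Fin 2 → ℝ) (i : Fin 2) :
    formOf a (EuclideanSpace.single i 1) = a i := by
  fin_cases i <;> simp [formOf]

/-- A mollified weakly curl-free field is a gradient on convex sets. -/
theorem exists_primitive_mollify {U V : Set Plane} (φ : ContDiffBump (0 : Plane))
    (hV : Convex ℝ V) (hVo : IsOpen V) (hVU : ∀ x ∈ V, closedBall x φ.rOut ⊆ U)
    {g : Fin 2 → Plane → ℝ} (hg : ∀ i, LocallyIntegrable (g i)) {M : NNReal}
    (hgM : ∀ i, ∀ᵐ x, x ∈ U → |g i x| ≤ M) (h : WeakClosed U g) (c : Plane) :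
    ∃ F : Plane → ℝ, LipschitzWith (2 * M) F ∧ F c = 0 ∧
      ∀ x ∈ V, HasFDerivAt F (formOf fun i => mollify φ (g i) x) x := by
  have hd : ∀ i, Differentiable ℝ (mollify φ (g i)) := fun i =>
    (contDiff_mollify φ (hg i)).differentiable (by simp)
  set w : Plane → Plane →L[ℝ] ℝ := fun x => formOf fun i => mollify φ (g i) x with hw0
  have hwd : ∀ x, HasFDerivAt w ((fderiv ℝ (mollify φ (g 0)) x).smulRight
      (EuclideanSpace.proj 0 : Plane →L[ℝ] ℝ) + (fderiv ℝ (mollify φ (g 1)) x).smulRight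
      (EuclideanSpace.proj 1 : Plane →L[ℝ] ℝ)) x := fun x =>
    ((hd 0 x).hasFDerivAt.smul_const (EuclideanSpace.proj 0 : Plane →L[ℝ] ℝ)).add
      ((hd 1 x).hasFDerivAt.smul_const (EuclideanSpace.proj 1 : Plane →L[ℝ] ℝ))
  -- the derivative of the form `w` is symmetric since the kernel is a test function for `h`
  obtain ⟨f, hf⟩ := hV.exists_forall_hasFDerivAt_of_fderiv_symmetric hVo
    (fun x _ => (hwd x).differentiableAt.differentiableWithinAt) (by
      intro a ha x y
      have hcl := h _ (isTest_kernel φ (hVU a ha))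
      have e0 := fderiv_mollify φ (hg 1) a 0
      have e1 := fderiv_mollify φ (hg 0) a 1
      rw [hcl, ← e1] at e0
      rw [(hwd a).fderiv]
      simp only [add_apply, ContinuousLinearMap.smulRight_apply, smul_apply, PiLp.proj_apply,
        smul_eq_mul]
      rw [clm_apply_eq (fderiv ℝ (mollify φ (g 0)) a) x,
        clm_apply_eq (fderiv ℝ (mollify φ (g 0)) a) y,
        clm_apply_eq (fderiv ℝ (mollify φ (g 1)) a) x,
        clm_apply_eq (fderiv ℝ (mollify φ (g 1)) a) y, e0]
      ring)
  have hlip : LipschitzOnWith (2 * M) f V := by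
    refine hV.lipschitzOnWith_of_nnnorm_hasFDerivWithin_le
      (fun x hx => (hf x hx).hasFDerivWithinAt) fun x hx => ?_
    rw [← NNReal.coe_le_coe]
    refine norm_clm_le_of_basis M.2 fun i => ?_
    rw [hw0, formOf_single]
    exact abs_mollify_le φ (hgM i) (hVU x hx)
  obtain ⟨F, hF, hFV⟩ := hlip.extend_real
  refine ⟨fun x => F x - F c, ?_, sub_self _, fun x hx => ?_⟩
  · refine LipschitzWith.of_dist_le_mul fun x y => ?_
    simpa using hF.dist_le_mul x y
  · refine HasFDerivAt.sub_const _ ((hf x hx).congr_of_eventuallyEq ?_)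
    filter_upwards [hVo.mem_nhds hx] with y hy using (hFV hy).symm

/-- Integration by parts against a test function. -/
theorem weakGrad_of_hasFDerivAt {V : Set Plane} {F : Plane → ℝ} {g : Fin 2 → Plane → ℝ}
    (hF : Continuous F) (hg : ∀ i, LocallyIntegrable (g i))
    (h : ∀ x ∈ V, HasFDerivAt F (formOf fun i => g i x) x) : WeakGrad V F g := by
  intro i ψ hψ
  have he : ∀ x, fderiv ℝ F x (EuclideanSpace.single i 1) * ψ x = g i x * ψ x := by
    intro x
    by_cases hx : x ∈ V
    · rw [(h x hx).fderiv, formOf_single]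
    · rw [hψ.eq_zero hx, mul_zero, mul_zero]
  have := integral_mul_fderiv_eq_neg_fderiv_mul_of_integrable (μ := volume) (f := F) (g := ψ)
    (v := EuclideanSpace.single i 1) ?_ ?_ ?_ (fun x hx => (h x (hψ.2.2 hx)).differentiableAt)
    (fun x _ => hψ.1.differentiable (by simp) x)
  · simp_rw [he] at this
    exact this
  · simp_rw [he]
    exact integrable_mul_of_hasCompactSupport (hg i) hψ.1.continuous hψ.2.1
  · exact integrable_mul_of_hasCompactSupport hF.locallyIntegrable (hψ.continuous_partialDeriv i)
      (hψ.hasCompactSupport_partialDeriv i)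
  · exact integrable_mul_of_hasCompactSupport hF.locallyIntegrable hψ.1.continuous hψ.2.1

/-- Arzelà–Ascoli for equi-Lipschitz functions on a ball. -/
theorem exists_subseq_tendsto_of_lipschitzWith {C : NNReal} {F : ℕ → Plane → ℝ} {c : Plane}
    (hF : ∀ n, LipschitzWith C (F n)) (hc : ∀ n, F n c = 0) (r : ℝ) :
    ∃ (f : Plane → ℝ) (s : ℕ → ℕ), LipschitzWith C f ∧ StrictMono s ∧
      ∀ x ∈ closedBall c r, Tendsto (fun n => F (s n) x) atTop (𝓝 (f x)) := by
  have : CompactSpace (closedBall c r) := isCompact_iff_compactSpace.1 (isCompact_closedBall c r)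
  let G : ℕ → BoundedContinuousFunction (closedBall c r) ℝ := fun n =>
    BoundedContinuousFunction.mkOfCompact
      ⟨fun x => F n x, (hF n).continuous.comp continuous_subtype_val⟩
  have hcomp : IsCompact (closure (range G)) := by
    refine BoundedContinuousFunction.arzela_ascoli (Icc (-(C * r)) (C * r)) isCompact_Icc _ ?_ ?_
    · rintro _ x ⟨n, rfl⟩
      have := (hF n).dist_le_mul x c
      rw [hc, dist_zero_right, Real.norm_eq_abs] at this
      have h2 : (C : ℝ) * dist (x : Plane) c ≤ C * r :=
        mul_le_mul_of_nonneg_left (mem_closedBall.1 x.2) C.2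
      exact abs_le.1 (this.trans h2)
    · refine (LipschitzWith.uniformEquicontinuous _ C ?_).equicontinuous
      rintro ⟨_, n, rfl⟩
      exact (hF n).comp (LipschitzWith.subtype_val _) |>.weaken (by simp)
  obtain ⟨f, -, s, hs, hlim⟩ := hcomp.tendsto_subseq fun n =>
    subset_closure (mem_range_self (f := G) n)
  have hpt : ∀ x : closedBall c r, Tendsto (fun n => F (s n) x) atTop (𝓝 (f x)) := fun x =>
    ((BoundedContinuousFunction.tendsto_iff_tendstoUniformly.1 hlim).tendsto_at x)
  classical
  have hlip : LipschitzOnWith C (fun x => if h : x ∈ closedBall c r then f ⟨x, h⟩ else 0)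
      (closedBall c r) := by
    refine LipschitzOnWith.of_dist_le_mul fun x hx y hy => ?_
    simp only [hx, hy, dif_pos]
    exact le_of_tendsto ((hpt ⟨x, hx⟩).dist (hpt ⟨y, hy⟩))
      (.of_forall fun n => (hF _).dist_le_mul _ _)
  obtain ⟨f', hf', hff'⟩ := hlip.extend_real
  refine ⟨f', s, hf', hs, fun x hx => ?_⟩
  rw [← hff' hx]
  simpa [hx] using hpt ⟨x, hx⟩

/-- Local primitives: a bounded weakly curl-free field on a ball is the weak gradient of a
Lipschitz function on the concentric ball of half the radius. It is the limit of primitives of the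
mollified field. -/
theorem exists_lipschitzWith_weakGrad {c : Plane} {r : ℝ} (hr : 0 < r)
    {g : Fin 2 → Plane → ℝ} (hg : ∀ i, LocallyIntegrable (g i)) {M : NNReal}
    (hgM : ∀ i, ∀ᵐ x, x ∈ ball c (2 * r) → |g i x| ≤ M) (h : WeakClosed (ball c (2 * r)) g) :
    ∃ F : Plane → ℝ, LipschitzWith (2 * M) F ∧ WeakGrad (ball c r) F g := by
  obtain ⟨N, hN⟩ := eventually_atTop.1 (tendsto_bumpSeq_rOut.eventually (gt_mem_nhds hr))
  have hVU : ∀ n, ∀ x ∈ ball c r, closedBall x (bumpSeq (n + N)).rOut ⊆ ball c (2 * r) := by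
    intro n x hx
    refine closedBall_subset_ball' ?_
    have := hN (n + N) (by omega)
    have := mem_ball.1 hx
    linarith
  choose F hF hFc hFd using fun n => exists_primitive_mollify (bumpSeq (n + N)) (convex_ball c r)
    isOpen_ball (hVU n) hg hgM h c
  obtain ⟨f, s, hf, hs, hlim⟩ := exists_subseq_tendsto_of_lipschitzWith hF hFc r
  refine ⟨f, hf, fun i ψ hψ => ?_⟩
  have hweak : ∀ n, ∫ x, F (s n) x * partialDeriv i ψ x =
      -∫ x, mollify (bumpSeq (s n + N)) (g i) x * ψ x := fun n =>
    weakGrad_of_hasFDerivAt (hF _).continuous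
      (fun j => (contDiff_mollify _ (hg j)).continuous.locallyIntegrable) (hFd (s n)) i ψ hψ
  have l1 : Tendsto (fun n => ∫ x, F (s n) x * partialDeriv i ψ x) atTop
      (𝓝 (∫ x, f x * partialDeriv i ψ x)) := by
    refine tendsto_integral_of_dominated_convergence (fun x => 2 * M * r * |partialDeriv i ψ x|)
      (fun n => ((hF _).continuous.mul (hψ.continuous_partialDeriv i)).aestronglyMeasurable)
      ?_ (fun n => .of_forall fun x => ?_) (.of_forall fun x => ?_)
    · exact (((hψ.continuous_partialDeriv i).integrable_of_hasCompactSupport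
        (hψ.hasCompactSupport_partialDeriv i)).abs).const_mul _
    · by_cases hx : x ∈ ball c r
      · rw [norm_mul, Real.norm_eq_abs, Real.norm_eq_abs]
        have h1 := (hF (s n)).dist_le_mul x c
        rw [hFc, dist_zero_right, Real.norm_eq_abs] at h1
        have h2 : ((2 * M : NNReal) : ℝ) * dist x c ≤ 2 * M * r := by
          push_cast
          exact mul_le_mul_of_nonneg_left (mem_ball.1 hx).le (by positivity)
        exact mul_le_mul_of_nonneg_right (h1.trans h2) (abs_nonneg _)
      · simp [hψ.partialDeriv_eq_zero i hx]
    · by_cases hx : x ∈ ball c r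
      · exact (hlim x (ball_subset_closedBall hx)).mul_const _
      · simp [hψ.partialDeriv_eq_zero i hx]
  have l2 : Tendsto (fun n => ∫ x, mollify (bumpSeq (s n + N)) (g i) x * ψ x) atTop
      (𝓝 (∫ x, g i x * ψ x)) := by
    refine tendsto_integral_of_dominated_convergence (fun x => M * |ψ x|)
      (fun n => (((contDiff_mollify _ (hg i)).continuous).mul
        hψ.1.continuous).aestronglyMeasurable) ?_ (fun n => .of_forall fun x => ?_) ?_
    · exact ((hψ.1.continuous.integrable_of_hasCompactSupport hψ.2.1).abs).const_mul _
    · by_cases hx : x ∈ ball c r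
      · rw [norm_mul, Real.norm_eq_abs, Real.norm_eq_abs]
        exact mul_le_mul_of_nonneg_right (abs_mollify_le _ (hgM i) (hVU _ x hx)) (abs_nonneg _)
      · simp [hψ.eq_zero hx]
    · filter_upwards [ae_tendsto_mollify (hg i)] with x hx
      exact (hx.comp ((tendsto_add_atTop_nat N).comp hs.tendsto_atTop)).mul_const _
  simp_rw [hweak] at l1
  exact tendsto_nhds_unique l1 l2.neg

/-! ### The Poincaré lemma on simply connected domains -/

/-- The real numbers with the discrete topology: the possible values of a locally constant
function, used as the fibre of a covering space. -/
@[ext]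
structure DiscreteReal where
  /-- The underlying real number. -/
  val : ℝ

instance : TopologicalSpace DiscreteReal := ⊥

instance : DiscreteTopology DiscreteReal := ⟨rfl⟩

/-- On a simply connected space, local functions whose differences are locally constant can be
glued up to local constants: the sheaf of possible constants is a covering space, which has a global
section. -/
theorem exists_glue_of_locally_const {B ι : Type*} [TopologicalSpace B] [SimplyConnectedSpace B]
    [LocallyPathConnectedSpace B] (U : ι → Set B) (hU : ∀ i, IsOpen (U i))
    (idx : B → ι) (hidx : ∀ x, x ∈ U (idx x)) (f : ι → B → ℝ)
    (h : ∀ i j, ∀ x ∈ U i ∩ U j, ∀ᶠ y in 𝓝 x, f i y - f j y = f i x - f j x) :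
    ∃ F : B → ℝ, ∀ i, ∀ x ∈ U i, ∀ᶠ y in 𝓝 x, F y - f i y = F x - f i x := by
  -- the fibre over `x` consists of the constants `c` such that `f i + c` is a possible value of `F`
  -- near `x`, the coordinate changes compensate the differences of the `f i`
  let Z : FiberBundleCore ι B DiscreteReal :=
    { baseSet := U
      isOpen_baseSet := hU
      indexAt := idx
      mem_baseSet_at := hidx
      coordChange := fun i j x v => ⟨v.val + (f i x - f j x)⟩
      coordChange_self := fun i x _ v => by simp
      continuousOn_coordChange := fun i j => by
        rintro ⟨x, v⟩ ⟨hx, -⟩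
        refine ContinuousAt.continuousWithinAt ?_
        unfold ContinuousAt
        rw [nhds_discrete DiscreteReal, nhds_prod_eq, nhds_discrete DiscreteReal, prod_pure]
        refine tendsto_pure.2 (eventually_map.2 ?_)
        filter_upwards [h i j x hx] with y hy
        exact congrArg (fun t : ℝ => DiscreteReal.mk (v.val + t)) hy
      coordChange_comp := fun i j k x _ v => by ext; simp; ring }
  have hcov : IsCoveringMap Z.proj := IsFiberBundle.isCoveringMap fun x =>
    ⟨Z.localTriv (idx x), hidx x⟩
  obtain ⟨x₀⟩ : Nonempty B := inferInstance
  obtain ⟨s, ⟨-, hs⟩, -⟩ := hcov.existsUnique_continuousMap_lifts (ContinuousMap.id B) x₀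
    (⟨x₀, (⟨0⟩ : DiscreteReal)⟩ : Z.TotalSpace) rfl
  have hs' : ∀ x, (s x).1 = x := fun x => congrFun hs x
  let c : B → DiscreteReal := fun x => (s x).2
  refine ⟨fun x => (c x).val + f (idx x) x, fun i x hx => ?_⟩
  have hc : ContinuousAt (fun y => (Z.localTriv i (s y)).2) x := by
    have h1 : s x ∈ (Z.localTriv i).source := by
      rw [Z.mem_localTriv_source, hs' x]; exact hx
    exact (((Z.localTriv i).toOpenPartialHomeomorph.continuousAt h1).comp
      s.continuous.continuousAt).snd
  rw [ContinuousAt, nhds_discrete DiscreteReal, tendsto_pure] at hc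
  have hval : ∀ y, ((Z.localTriv i (s y)).2).val = (c y).val + (f (idx y) y - f i y) := by
    intro y
    rw [Z.localTriv_apply]
    show (c y).val + (f (idx (s y).1) (s y).1 - f i (s y).1) = _
    rw [hs' y]
  filter_upwards [hc] with y hy
  have hy' := congrArg DiscreteReal.val hy
  rw [hval, hval] at hy'
  linarith

theorem integrable_mul_of_locallyIntegrableOn {U : Set Plane} {u χ : Plane → ℝ}
    (hu : LocallyIntegrableOn u U) (hχ : Continuous χ) (hc : HasCompactSupport χ)
    (hs : tsupport χ ⊆ U) : Integrable fun x => u x * χ x := by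
  have h1 : IntegrableOn u (tsupport χ) := hu.integrableOn_compact_subset hs hc
  have h2 : IntegrableOn (fun x => u x * χ x) (tsupport χ) :=
    h1.mul_continuousOn hχ.continuousOn hc
  rwa [integrableOn_iff_integrable_of_support_subset] at h2
  intro x hx
  exact subset_tsupport _ (right_ne_zero_of_mul hx)

theorem partialDeriv_sum {ι : Type*} (s : Finset ι) {ψ : ι → Plane → ℝ}
    (hψ : ∀ j ∈ s, ContDiff ℝ ∞ (ψ j)) (i : Fin 2) (x : Plane) :
    partialDeriv i (fun x => ∑ j ∈ s, ψ j x) x = ∑ j ∈ s, partialDeriv i (ψ j) x := by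
  have := HasFDerivAt.fun_sum fun j hj => ((hψ j hj).differentiable (by simp) x).hasFDerivAt
  rw [partialDeriv, this.fderiv]
  simp [partialDeriv]

/-- A test function is a finite sum of test functions supported in the members of an open cover. -/
theorem IsTest.exists_sum {U : Set Plane} {ψ : Plane → ℝ} (hψ : IsTest U ψ) {V : Plane → Set Plane}
    (hV : ∀ x ∈ U, IsOpen (V x) ∧ x ∈ V x) :
    ∃ (t : Finset Plane) (ψ' : t → Plane → ℝ), (∀ c : t, (c : Plane) ∈ U ∧ IsTest (V c) (ψ' c)) ∧
      (∀ c : t, tsupport (ψ' c) ⊆ tsupport ψ) ∧ ψ = fun x => ∑ c, ψ' c x := by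
  obtain ⟨t, htU, ht⟩ := hψ.2.1.isCompact.elim_nhds_subcover V
    fun x hx => (hV x (hψ.2.2 hx)).1.mem_nhds (hV x (hψ.2.2 hx)).2
  obtain ⟨ρ, hρ⟩ := SmoothPartitionOfUnity.exists_isSubordinate (modelWithCornersSelf ℝ Plane)
    (isClosed_tsupport ψ) (fun c : t => V c) (fun c => (hV _ (hψ.2.2 (htU c c.2))).1)
    (fun x hx => by simpa using ht hx)
  have hs : ∀ c : t, tsupport (fun x => ρ c x * ψ x) ⊆ tsupport ψ := fun c =>
    closure_mono fun x hx => right_ne_zero_of_mul hx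
  refine ⟨t, fun c x => ρ c x * ψ x, fun c => ⟨hψ.2.2 (htU c c.2), ?_, ?_, ?_⟩, hs, ?_⟩
  · exact (ρ c).contMDiff.contDiff.mul hψ.1
  · exact hψ.2.1.of_isClosed_subset (isClosed_tsupport _) (hs c)
  · exact (closure_mono fun x hx => left_ne_zero_of_mul hx).trans (hρ c)
  · ext x
    rw [← Finset.sum_mul]
    by_cases hx : x ∈ tsupport ψ
    · have := ρ.sum_eq_one hx
      rw [finsum_eq_sum_of_fintype] at this
      rw [this, one_mul]
    · rw [image_eq_zero_of_notMem_tsupport hx, mul_zero]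

/-- Being a weak gradient is a local property. -/
theorem WeakGrad.of_local {U : Set Plane} {u : Plane → ℝ} {g : Fin 2 → Plane → ℝ}
    (hu : LocallyIntegrableOn u U) (hg : ∀ i, LocallyIntegrableOn (g i) U)
    (h : ∀ x ∈ U, ∃ V, IsOpen V ∧ x ∈ V ∧ WeakGrad V u g) : WeakGrad U u g := by
  intro i ψ hψ
  choose! V hVo hxV hV using h
  obtain ⟨t, ψ', ht, hts, rfl⟩ := hψ.exists_sum fun x hx => ⟨hVo x hx, hxV x hx⟩
  have hd : ∀ x, partialDeriv i (fun x => ∑ c, ψ' c x) x = ∑ c, partialDeriv i (ψ' c) x :=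
    fun x => partialDeriv_sum _ (fun c _ => (ht c).2.1) i x
  simp_rw [hd, Finset.mul_sum]
  rw [integral_finsetSum, integral_finsetSum, ← Finset.sum_neg_distrib]
  · exact Finset.sum_congr rfl fun c _ => hV c (ht c).1 i _ (ht c).2
  · exact fun c _ => integrable_mul_of_locallyIntegrableOn (hg i) (ht c).2.1.continuous
      (ht c).2.2.1 ((hts c).trans hψ.2.2)
  · exact fun c _ => integrable_mul_of_locallyIntegrableOn hu
      ((ht c).2.continuous_partialDeriv i) ((ht c).2.hasCompactSupport_partialDeriv i)
      ((tsupport_partialDeriv_subset i _).trans ((hts c).trans hψ.2.2))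

theorem WeakGrad.mono {U V : Set Plane} {u : Plane → ℝ} {g : Fin 2 → Plane → ℝ}
    (h : WeakGrad U u g) (hVU : V ⊆ U) : WeakGrad V u g :=
  fun i ψ hψ => h i ψ ⟨hψ.1, hψ.2.1, hψ.2.2.trans hVU⟩

theorem WeakGrad.congr {U : Set Plane} {u u' : Plane → ℝ} {g g' : Fin 2 → Plane → ℝ}
    (h : WeakGrad U u g) (hu : ∀ᵐ x, x ∈ U → u x = u' x) (hg : ∀ i, ∀ᵐ x, x ∈ U → g i x = g' i x) :
    WeakGrad U u' g' := by
  intro i ψ hψ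
  have e1 : ∫ x, u' x * partialDeriv i ψ x = ∫ x, u x * partialDeriv i ψ x := by
    refine integral_congr_ae ?_
    filter_upwards [hu] with x hx
    by_cases hxU : x ∈ U
    · simp only [hx hxU]
    · simp only [hψ.partialDeriv_eq_zero i hxU, mul_zero]
  have e2 : ∫ x, g' i x * ψ x = ∫ x, g i x * ψ x := by
    refine integral_congr_ae ?_
    filter_upwards [hg i] with x hx
    by_cases hxU : x ∈ U
    · simp only [hx hxU]
    · simp only [hψ.eq_zero hxU, mul_zero]
  rw [e1, e2, h i ψ hψ]

theorem WeakGrad.sub {U : Set Plane} {u u' : Plane → ℝ} {g g' : Fin 2 → Plane → ℝ}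
    (h : WeakGrad U u g) (h' : WeakGrad U u' g') (hu : LocallyIntegrableOn u U)
    (hu' : LocallyIntegrableOn u' U) (hg : ∀ i, LocallyIntegrableOn (g i) U)
    (hg' : ∀ i, LocallyIntegrableOn (g' i) U) :
    WeakGrad U (fun x => u x - u' x) (fun i x => g i x - g' i x) := by
  intro i ψ hψ
  have hc := hψ.continuous_partialDeriv i
  have hk := hψ.hasCompactSupport_partialDeriv i
  have hs := (tsupport_partialDeriv_subset i ψ).trans hψ.2.2
  simp_rw [sub_mul]
  rw [integral_sub (integrable_mul_of_locallyIntegrableOn hu hc hk hs)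
      (integrable_mul_of_locallyIntegrableOn hu' hc hk hs),
    integral_sub (integrable_mul_of_locallyIntegrableOn (hg i) hψ.1.continuous hψ.2.1 hψ.2.2)
      (integrable_mul_of_locallyIntegrableOn (hg' i) hψ.1.continuous hψ.2.1 hψ.2.2),
    h i ψ hψ, h' i ψ hψ]
  ring

/-- A continuous function with vanishing weak gradient is locally constant. -/
theorem WeakGrad.eventually_eq {U : Set Plane} (hU : IsOpen U) {u : Plane → ℝ}
    (hu : ContinuousOn u U) (h : WeakGrad U u 0) {x : Plane} (hx : x ∈ U) :
    ∀ᶠ y in 𝓝 x, u y = u x := by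
  obtain ⟨r, hr, hrU⟩ := Metric.nhds_basis_closedBall.mem_iff.1 (hU.mem_nhds hx)
  have hbU : ball x r ⊆ U := ball_subset_closedBall.trans hrU
  have hint : Integrable ((ball x r).indicator u) := by
    rw [integrable_indicator_iff measurableSet_ball]
    exact ((hu.mono hrU).integrableOn_compact (isCompact_closedBall x r)).mono_set
      ball_subset_closedBall
  have hw : WeakGrad (ball x r) ((ball x r).indicator u) 0 :=
    (h.mono hbU).congr (.of_forall fun y hy => (indicator_of_mem hy u).symm)
      fun i => .of_forall fun y hy => rfl
  obtain ⟨f, hf, hfe⟩ := exists_lipschitzWith_of_weakGrad isOpen_ball (convex_ball x r)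
    hint.locallyIntegrable (M := 0) (fun i => .of_forall fun y _ => by simp) hw
  have heq : EqOn u f (ball x r) := by
    refine Measure.eqOn_open_of_ae_eq (μ := volume) ?_ isOpen_ball (hu.mono hbU)
      hf.continuous.continuousOn
    refine (ae_restrict_iff' measurableSet_ball).2 ?_
    filter_upwards [hfe] with y hy hyb
    rw [← hy hyb, indicator_of_mem hyb]
  filter_upwards [ball_mem_nhds x hr] with y hy
  rw [heq hy, heq (mem_ball_self hr)]
  have := hf.dist_le_mul y x
  simpa using this

theorem WeakGrad.exists_eq_const {U : Set Plane} (hU : IsOpen U) (hUc : IsPreconnected U)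
    {u : Plane → ℝ} (hu : ContinuousOn u U) (h : WeakGrad U u 0) : ∃ c, ∀ x ∈ U, u x = c := by
  rcases U.eq_empty_or_nonempty with rfl | ⟨x₀, hx₀⟩
  · exact ⟨0, by simp⟩
  have : PreconnectedSpace U := isPreconnected_iff_preconnectedSpace.1 hUc
  have hl : IsLocallyConstant fun x : U => u x := by
    rw [IsLocallyConstant.iff_eventually_eq]
    intro x
    exact continuous_subtype_val.continuousAt.eventually (h.eventually_eq hU hu x.2)
  exact ⟨u x₀, fun x hx => hl.apply_eq_of_preconnectedSpace ⟨x, hx⟩ ⟨x₀, hx₀⟩⟩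

/-- The Poincaré lemma for bounded weakly curl-free fields on simply connected open sets. -/
theorem exists_continuousOn_weakGrad {Ω : Set Plane} (hΩ : IsOpen Ω) [SimplyConnectedSpace Ω]
    {g : Fin 2 → Plane → ℝ} (hg : ∀ i, LocallyIntegrable (g i)) {M : NNReal}
    (hgM : ∀ i, ∀ᵐ x, x ∈ Ω → |g i x| ≤ M) (h : WeakClosed Ω g) :
    ∃ F : Plane → ℝ, ContinuousOn F Ω ∧ WeakGrad Ω F g := by
  have hloc : ∀ x : Ω, ∃ r > 0, ball (x : Plane) (2 * r) ⊆ Ω ∧ ∃ f : Plane → ℝ, Continuous f ∧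
      WeakGrad (ball (x : Plane) r) f g := by
    intro x
    obtain ⟨r, hr, hrΩ⟩ := Metric.isOpen_iff.1 hΩ x x.2
    have hrr : 2 * (r / 2) = r := by ring
    refine ⟨r / 2, by positivity, by rwa [hrr], ?_⟩
    have hgM' : ∀ i, ∀ᵐ y, y ∈ ball (x : Plane) (2 * (r / 2)) → |g i y| ≤ M := by
      intro i
      filter_upwards [hgM i] with y hy hyb
      exact hy (hrΩ (by rwa [hrr] at hyb))
    obtain ⟨f, hf, hfw⟩ := exists_lipschitzWith_weakGrad (half_pos hr) hg hgM'
      fun ψ hψ => h ψ ⟨hψ.1, hψ.2.1, hψ.2.2.trans (by rwa [hrr])⟩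
    exact ⟨f, hf.continuous, hfw⟩
  choose r hr hrΩ f hf hfw using hloc
  have := hΩ.locallyPathConnectedSpace
  obtain ⟨F, hF⟩ := exists_glue_of_locally_const
    (fun x : Ω => (Subtype.val ⁻¹' ball (x : Plane) (r x) : Set Ω))
    (fun x => isOpen_ball.preimage continuous_subtype_val) id (fun x => mem_ball_self (hr x))
    (fun x y => f x y) (by
      intro x y z hz
      have hw := ((hfw x).mono (inter_subset_left (t := ball (y : Plane) (r y)))).sub
        ((hfw y).mono (inter_subset_right (s := ball (x : Plane) (r x))))
        ((hf x).locallyIntegrable.locallyIntegrableOn _)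
        ((hf y).locallyIntegrable.locallyIntegrableOn _)
        (fun i => (hg i).locallyIntegrableOn _) (fun i => (hg i).locallyIntegrableOn _)
      have hw0 := hw.congr (g' := 0) (.of_forall fun _ _ => rfl)
        (fun i => .of_forall fun _ _ => sub_self _)
      exact continuous_subtype_val.continuousAt.eventually
        (hw0.eventually_eq (isOpen_ball.inter isOpen_ball)
          ((hf x).sub (hf y)).continuousOn (x := (z : Plane)) hz))
  classical
  set G : Plane → ℝ := fun x => if hx : x ∈ Ω then F ⟨x, hx⟩ else 0 with hG
  have hGe : ∀ x : Ω, ∀ᶠ y in 𝓝 (x : Plane), G y = f x y + (G x - f x x) := by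
    intro x
    have h1 := hF x x (mem_ball_self (hr x))
    rw [nhds_subtype_eq_comap, eventually_comap] at h1
    filter_upwards [h1, hΩ.mem_nhds x.2] with y hy hyΩ
    have := hy ⟨y, hyΩ⟩ rfl
    simp only [hG, hyΩ, dif_pos, x.2]
    linarith
  have hGc : ContinuousOn G Ω := fun x hx =>
    (((hf ⟨x, hx⟩).add continuous_const).continuousAt.congr
      (EventuallyEq.symm (hGe ⟨x, hx⟩))).continuousWithinAt
  refine ⟨G, hGc, WeakGrad.of_local (hGc.locallyIntegrableOn hΩ.measurableSet)
    (fun i => (hg i).locallyIntegrableOn _) fun x hx => ?_⟩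
  obtain ⟨ε, hε, hεG⟩ := Metric.eventually_nhds_iff_ball.1 (hGe ⟨x, hx⟩)
  refine ⟨ball x (min ε (r ⟨x, hx⟩)), isOpen_ball, mem_ball_self (lt_min hε (hr _)), ?_⟩
  have hconst : WeakGrad (ball x (min ε (r ⟨x, hx⟩))) (fun _ => -(G x - f ⟨x, hx⟩ x)) 0 :=
    weakGrad_of_hasFDerivAt continuous_const (fun i => by exact locallyIntegrable_const 0)
      fun y _ => by
        have : (formOf fun i : Fin 2 => (0 : Fin 2 → Plane → ℝ) i y) = 0 := by
          ext; simp [formOf]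
        rw [this]; exact hasFDerivAt_const _ _
  have := ((hfw ⟨x, hx⟩).mono (ball_subset_ball (min_le_right ε _))).sub hconst
    ((hf _).locallyIntegrable.locallyIntegrableOn _)
    (continuous_const.locallyIntegrable.locallyIntegrableOn _)
    (fun i => (hg i).locallyIntegrableOn _)
    (fun i => by exact (locallyIntegrable_const 0).locallyIntegrableOn _)
  refine this.congr (.of_forall fun y hy => ?_) fun i => .of_forall fun y _ => by simp
  rw [hεG y (ball_subset_ball (min_le_left _ _) hy)]
  ring

/-! ### Polynomial potentials -/

open MvPolynomial in
/-- The antiderivative with respect to the `i`-th variable that vanishes where this variable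
does. -/
noncomputable def antideriv (i : Fin 2) : Poly →ₗ[ℝ] Poly :=
  (basisMonomials (Fin 2) ℝ).constr ℝ fun s =>
    monomial (s + Finsupp.single i 1) (1 / ((s i : ℝ) + 1))

theorem antideriv_monomial (i : Fin 2) (s : Fin 2 →₀ ℕ) (a : ℝ) :
    antideriv i (MvPolynomial.monomial s a) =
      MvPolynomial.monomial (s + Finsupp.single i 1) (a / ((s i : ℝ) + 1)) := by
  have h1 : antideriv i (MvPolynomial.monomial s 1) =
      MvPolynomial.monomial (s + Finsupp.single i 1) (1 / ((s i : ℝ) + 1)) := by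
    have := (MvPolynomial.basisMonomials (Fin 2) ℝ).constr_basis ℝ (fun s : Fin 2 →₀ ℕ =>
      MvPolynomial.monomial (s + Finsupp.single i 1) (1 / ((s i : ℝ) + 1))) s
    simpa [antideriv] using this
  have h2 : MvPolynomial.monomial s a = a • MvPolynomial.monomial s (1 : ℝ) := by
    rw [MvPolynomial.smul_monomial, smul_eq_mul, mul_one]
  rw [h2, map_smul, h1, MvPolynomial.smul_monomial, smul_eq_mul, mul_one_div]

theorem pderiv_antideriv (i : Fin 2) (p : Poly) : MvPolynomial.pderiv i (antideriv i p) = p := by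
  induction p using MvPolynomial.induction_on' with
  | monomial s a =>
    have h : (s i : ℝ) + 1 ≠ 0 := by positivity
    rw [antideriv_monomial, MvPolynomial.pderiv_monomial, add_tsub_cancel_right]
    simp [div_mul_cancel₀ a h]
  | add p q hp hq => rw [map_add, map_add, hp, hq]

theorem pderiv_antideriv_of_ne {i j : Fin 2} (hij : i ≠ j) (p : Poly) :
    MvPolynomial.pderiv j (antideriv i p) = antideriv i (MvPolynomial.pderiv j p) := by
  induction p using MvPolynomial.induction_on' with
  | monomial s a =>
    rw [antideriv_monomial, MvPolynomial.pderiv_monomial, MvPolynomial.pderiv_monomial,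
      antideriv_monomial]
    have h1 : s + Finsupp.single i 1 - Finsupp.single j 1 =
        s - Finsupp.single j 1 + Finsupp.single i 1 := by
      ext l
      simp only [Finsupp.coe_tsub, Finsupp.coe_add, Pi.sub_apply, Pi.add_apply,
        Finsupp.single_apply]
      split_ifs <;> omega
    rw [h1]
    simp only [Finsupp.coe_tsub, Finsupp.coe_add, Pi.sub_apply, Pi.add_apply,
      Finsupp.single_apply, hij, hij.symm, if_false, add_zero, tsub_zero]
    congr 1
    ring
  | add p q hp hq => simp only [map_add, hp, hq]

theorem totalDegree_antideriv_le (i : Fin 2) (p : Poly) :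
    (antideriv i p).totalDegree ≤ p.totalDegree + 1 := by
  conv_lhs => rw [p.as_sum, map_sum]
  refine MvPolynomial.totalDegree_finsetSum_le fun s hs => ?_
  rw [antideriv_monomial]
  refine (MvPolynomial.totalDegree_monomial_le _ _).trans ?_
  have := MvPolynomial.le_totalDegree hs
  rw [Finsupp.sum_fintype _ _ (fun _ => rfl), Fin.sum_univ_two] at this ⊢
  fin_cases i <;> simp <;> omega

/-- This bound does not follow from `totalDegree_antideriv_le`, as a constant and its
derivative both have total degree `0`. -/
theorem totalDegree_antideriv_pderiv_le (i j : Fin 2) (p : Poly) :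
    (antideriv i (MvPolynomial.pderiv j p)).totalDegree ≤ p.totalDegree := by
  conv_lhs => rw [p.as_sum, map_sum, map_sum]
  refine MvPolynomial.totalDegree_finsetSum_le fun s hs => ?_
  rw [MvPolynomial.pderiv_monomial, antideriv_monomial]
  rcases Nat.eq_zero_or_pos (s j) with h0 | h0
  · simp [h0]
  refine (MvPolynomial.totalDegree_monomial_le _ _).trans ?_
  have := MvPolynomial.le_totalDegree hs
  rw [Finsupp.sum_fintype _ _ (fun _ => rfl), Fin.sum_univ_two] at this ⊢
  fin_cases i <;> fin_cases j <;> simp at h0 ⊢ <;> omega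

/-- A polynomial field that is curl-free has a polynomial potential. -/
theorem exists_potential {m : ℕ} {P : Fin 2 → Poly} (hP : ∀ i, (P i).totalDegree ≤ m)
    (h : MvPolynomial.pderiv 0 (P 1) = MvPolynomial.pderiv 1 (P 0)) :
    ∃ p : Poly, p.totalDegree ≤ m + 1 ∧ ∀ i, MvPolynomial.pderiv i p = P i := by
  -- `q` is the part of `P 1` that the potential `antideriv 0 (P 0)` misses
  set q := P 1 - antideriv 0 (MvPolynomial.pderiv 1 (P 0)) with hq
  have hq0 : MvPolynomial.pderiv 0 q = 0 := by
    rw [hq, map_sub, pderiv_antideriv, h, sub_self]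
  refine ⟨antideriv 0 (P 0) + antideriv 1 q, ?_, ?_⟩
  · have h1 := totalDegree_antideriv_le 0 (P 0)
    have h2 := totalDegree_antideriv_le 1 q
    have h3 := totalDegree_antideriv_pderiv_le 0 1 (P 0)
    have h4 := MvPolynomial.totalDegree_sub (P 1) (antideriv 0 (MvPolynomial.pderiv 1 (P 0)))
    have h5 := MvPolynomial.totalDegree_add (antideriv 0 (P 0)) (antideriv 1 q)
    have h6 := hP 0
    have h7 := hP 1
    rw [← hq] at h4
    rcases le_max_iff.1 h4 with h | h <;> rcases le_max_iff.1 h5 with h' | h' <;> omega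
  · intro i
    fin_cases i
    · show MvPolynomial.pderiv 0 _ = P 0
      rw [map_add, pderiv_antideriv, pderiv_antideriv_of_ne (by decide), hq0, map_zero, add_zero]
    · show MvPolynomial.pderiv 1 _ = P 1
      rw [map_add, pderiv_antideriv, pderiv_antideriv_of_ne (by decide), hq]
      ring

/-! ### Polynomials as functions -/

theorem val_add (p q : Poly) (x : Plane) : val (p + q) x = val p x + val q x := map_add _ _ _
theorem val_sub (p q : Poly) (x : Plane) : val (p - q) x = val p x - val q x := map_sub _ _ _
theorem val_neg (p : Poly) (x : Plane) : val (-p) x = -val p x := map_neg _ _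
theorem val_mul (p q : Poly) (x : Plane) : val (p * q) x = val p x * val q x := map_mul _ _ _
theorem val_C (a : ℝ) (x : Plane) : val (MvPolynomial.C a) x = a := MvPolynomial.eval_C _
theorem val_X (i : Fin 2) (x : Plane) : val (MvPolynomial.X i) x = x i := MvPolynomial.eval_X _

theorem hasFDerivAt_val (p : Poly) (x : Plane) :
    HasFDerivAt (val p) (formOf fun i => val (MvPolynomial.pderiv i p) x) x := by
  induction p using MvPolynomial.induction_on with
  | C a =>
    have h1 : val (MvPolynomial.C a) = fun _ => a := by ext; exact val_C _ _
    have h2 : (formOf fun i => val (MvPolynomial.pderiv i (MvPolynomial.C a)) x) = 0 := by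
      ext; simp [formOf, val]
    rw [h1, h2]
    exact hasFDerivAt_const _ _
  | add p q hp hq =>
    have h1 : val (p + q) = fun x => val p x + val q x := by ext; exact val_add _ _ _
    rw [h1]
    refine (hp.add hq).congr_fderiv ?_
    ext
    simp [formOf, val_add]
    ring
  | mul_X p j hp =>
    have h1 : val (p * MvPolynomial.X j) = fun x => val p x * x j := by
      ext; rw [val_mul, val_X]
    have h2 : HasFDerivAt (fun x : Plane => x j) (EuclideanSpace.proj j : Plane →L[ℝ] ℝ) x :=
      (EuclideanSpace.proj j : Plane →L[ℝ] ℝ).hasFDerivAt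
    rw [h1]
    refine (hp.mul h2).congr_fderiv ?_
    ext w
    fin_cases j <;> simp [formOf, val] <;> ring

theorem continuous_val (p : Poly) : Continuous (val p) :=
  continuous_iff_continuousAt.2 fun x => (hasFDerivAt_val p x).continuousAt

theorem locallyIntegrable_val (p : Poly) : LocallyIntegrable (val p) :=
  (continuous_val p).locallyIntegrable

theorem weakGrad_val (U : Set Plane) (p : Poly) :
    WeakGrad U (val p) fun i => val (MvPolynomial.pderiv i p) :=
  weakGrad_of_hasFDerivAt (continuous_val p) (fun _ => locallyIntegrable_val _)
    fun x _ => hasFDerivAt_val p x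

/-- A polynomial is determined by its values on a nonempty open set. -/
theorem eq_of_val_eq {U : Set Plane} (hU : IsOpen U) (hne : U.Nonempty) {p q : Poly}
    (h : ∀ x ∈ U, val p x = val q x) : p = q := by
  obtain ⟨x, hx⟩ := hne
  have hV : IsOpen ((WithLp.toLp 2 : (Fin 2 → ℝ) → Plane) ⁻¹' U) :=
    hU.preimage (PiLp.continuous_toLp 2 _)
  obtain ⟨r, hr, hrU⟩ := Metric.isOpen_iff.1 hV x.ofLp hx
  rw [ball_pi _ hr] at hrU
  exact MvPolynomial.funext_set (fun i => ball (x.ofLp i) r)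
    (fun i => infinite_of_mem_nhds _ (ball_mem_nhds _ hr)) fun y hy => h _ (hrU hy)

theorem eq_val_of_ae_eq {U : Set Plane} (hU : IsOpen U) {f : Plane → ℝ} (hf : ContinuousOn f U)
    {p : Poly} (h : ∀ᵐ x, x ∈ U → f x = val p x) : ∀ x ∈ U, f x = val p x :=
  Measure.eqOn_open_of_ae_eq (μ := volume) ((ae_restrict_iff' hU.measurableSet).2 h) hU hf
    (continuous_val p).continuousOn

/-- A continuous function with a polynomial weak gradient is a polynomial. -/
theorem exists_eq_val_of_weakGrad {U : Set Plane} (hU : IsOpen U) (hUc : IsPreconnected U)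
    (hne : U.Nonempty) {F : Plane → ℝ} (hF : ContinuousOn F U) {g : Fin 2 → Plane → ℝ}
    (hw : WeakGrad U F g) (hcl : WeakClosed U g) {m : ℕ} {P : Fin 2 → Poly}
    (hg : ∀ i, ∀ᵐ x, x ∈ U → g i x = val (P i) x) (hP : ∀ i, (P i).totalDegree ≤ m) :
    ∃ p : Poly, p.totalDegree ≤ m + 1 ∧ (∀ i, MvPolynomial.pderiv i p = P i) ∧
      ∀ x ∈ U, F x = val p x := by
  have hint : ∀ i j ψ, IsTest U ψ → ∫ x, g i x * partialDeriv j ψ x =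
      -∫ x, val (MvPolynomial.pderiv j (P i)) x * ψ x := by
    intro i j ψ hψ
    rw [← weakGrad_val U (P i) j ψ hψ]
    refine integral_congr_ae ?_
    filter_upwards [hg i] with x hx
    by_cases hxU : x ∈ U
    · simp only [hx hxU]
    · simp only [hψ.partialDeriv_eq_zero j hxU, mul_zero]
  have hclosed : MvPolynomial.pderiv 0 (P 1) = MvPolynomial.pderiv 1 (P 0) := by
    have hae : ∀ᵐ x, x ∈ U → val (MvPolynomial.pderiv 0 (P 1) - MvPolynomial.pderiv 1 (P 0)) x
        = 0 := by
      refine hU.ae_eq_zero_of_integral_contDiff_smul_eq_zero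
        ((locallyIntegrable_val _).locallyIntegrableOn _) fun ψ h1 h2 h3 => ?_
      have h := hcl ψ ⟨h1, h2, h3⟩
      rw [hint 1 0 ψ ⟨h1, h2, h3⟩, hint 0 1 ψ ⟨h1, h2, h3⟩, neg_inj] at h
      simp_rw [val_sub, smul_eq_mul, mul_comm (ψ _), sub_mul]
      rw [integral_sub, h, sub_self] <;>
      exact integrable_mul_of_hasCompactSupport (locallyIntegrable_val _) h1.continuous h2
    have h0 := eq_val_of_ae_eq hU (f := fun _ => 0) (p := MvPolynomial.pderiv 0 (P 1) -
      MvPolynomial.pderiv 1 (P 0)) continuousOn_const (by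
        filter_upwards [hae] with x hx hxU using (hx hxU).symm)
    refine eq_of_val_eq hU hne fun x hx => ?_
    have := h0 x hx
    rw [val_sub] at this
    linarith
  obtain ⟨p, hp, hpP⟩ := exists_potential hP hclosed
  have hg' : ∀ i, LocallyIntegrableOn (val (P i)) U := fun i =>
    (locallyIntegrable_val _).locallyIntegrableOn _
  have hF' : WeakGrad U F fun i => val (P i) := hw.congr (.of_forall fun _ _ => rfl) hg
  have hp' : WeakGrad U (val p) fun i => val (P i) := by
    have := weakGrad_val U p
    simpa only [hpP] using this
  have hsub := hF'.sub hp' (hF.locallyIntegrableOn hU.measurableSet)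
    ((locallyIntegrable_val _).locallyIntegrableOn _) hg' hg'
  obtain ⟨c, hc⟩ := (hsub.congr (g' := 0) (.of_forall fun _ _ => rfl)
    fun i => .of_forall fun _ _ => sub_self _).exists_eq_const hU hUc
      (hF.sub (continuous_val p).continuousOn)
  refine ⟨p + MvPolynomial.C c, ?_, fun i => ?_, fun x hx => ?_⟩
  · refine (MvPolynomial.totalDegree_add _ _).trans ?_
    simpa using hp
  · rw [map_add, hpP, MvPolynomial.pderiv_C, add_zero]
  · have := hc x hx
    rw [Pi.sub_apply] at this
    rw [val_add, val_C]
    linarith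

/-! ### Triangulations -/

namespace Triangle

theorem convex_carrier (K : Triangle) : Convex ℝ K.carrier := convex_convexHull _ _

theorem isCompact_carrier (K : Triangle) : IsCompact K.carrier :=
  (finite_range K.points).isCompact_convexHull (𝕜 := ℝ)

theorem isClosed_carrier (K : Triangle) : IsClosed K.carrier := K.isCompact_carrier.isClosed

theorem interior_carrier (K : Triangle) : interior K.carrier = {x | ∀ i, 0 < K.bary i x} :=
  K.basis.interior_convexHull

theorem nonempty_interior (K : Triangle) : (interior K.carrier).Nonempty :=
  ⟨_, K.basis.centroid_mem_interior_convexHull⟩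

theorem subset_closure_interior (K : Triangle) : K.carrier ⊆ closure (interior K.carrier) := by
  rw [K.convex_carrier.closure_interior_eq_closure_of_nonempty_interior K.nonempty_interior]
  exact subset_closure

theorem isPreconnected_interior (K : Triangle) : IsPreconnected (interior K.carrier) :=
  K.convex_carrier.interior.isPreconnected

theorem ae_mem_interior (K : Triangle) : ∀ᵐ x, x ∈ K.carrier → x ∈ interior K.carrier := by
  have h : volume (frontier K.carrier) = 0 := K.convex_carrier.addHaar_frontier volume
  filter_upwards [measure_eq_zero_iff_ae_notMem.1 h] with x hx hxK
  by_contra hxi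
  exact hx ⟨subset_closure hxK, hxi⟩

theorem ncard_verts (K : Triangle) : K.verts.ncard = 3 := by
  rw [verts, ← image_univ, ncard_image_of_injective _ K.independent.injective, ncard_univ]
  simp

theorem bary_vert (K : Triangle) (i j : Fin 3) : K.bary i (K.points j) = if i = j then 1 else 0 :=
  K.basis.coord_apply i j

theorem vert_mem_carrier (K : Triangle) {x : Plane} (hx : x ∈ K.verts) : x ∈ K.carrier :=
  subset_convexHull _ _ hx

end Triangle

section Triangulation

variable {Ω : Set Plane} {T : Set Triangle}

theorem IsRegularTriangulation.carrier_subset (hT : IsRegularTriangulation Ω T) {K : Triangle}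
    (hK : K ∈ T) : K.carrier ⊆ closure Ω := by
  rw [← hT.cover]; exact subset_biUnion_of_mem hK

theorem IsRegularTriangulation.interior_carrier_subset (hT : IsRegularTriangulation Ω T)
    (hΩ : IsPolygonalDomain Ω) {K : Triangle} (hK : K ∈ T) : interior K.carrier ⊆ Ω := by
  have := interior_mono (hT.carrier_subset hK)
  rwa [hΩ.one_sided] at this

theorem IsRegularTriangulation.exists_mem (hT : IsRegularTriangulation Ω T) {x : Plane}
    (hx : x ∈ closure Ω) : ∃ K ∈ T, x ∈ K.carrier := by
  rw [← hT.cover] at hx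
  simpa using hx

theorem IsRegularTriangulation.ae_exists_interior (hT : IsRegularTriangulation Ω T) :
    ∀ᵐ x, x ∈ Ω → ∃ K ∈ T, x ∈ interior K.carrier := by
  have : ∀ᵐ x, ∀ K ∈ T, x ∈ K.carrier → x ∈ interior K.carrier :=
    (ae_ball_iff hT.finite.countable).2 fun K _ => K.ae_mem_interior
  filter_upwards [this] with x hx hxΩ
  obtain ⟨K, hK, hxK⟩ := hT.exists_mem (subset_closure hxΩ)
  exact ⟨K, hK, hx K hK hxK⟩

/-- A point in the interior of a triangle of a conforming mesh lies in no other triangle. -/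
theorem IsRegularTriangulation.eq_of_mem_interior (hT : IsRegularTriangulation Ω T)
    {K K' : Triangle} (hK : K ∈ T) (hK' : K' ∈ T) {x : Plane} (hx : x ∈ interior K.carrier)
    (hx' : x ∈ K'.carrier) : K' = K := by
  by_contra hne
  obtain ⟨hv, hc⟩ := hT.conforming K hK K' hK' (Ne.symm hne)
  have hxc : x ∈ convexHull ℝ (K.verts ∩ K'.verts) := hc ▸ ⟨interior_subset hx, hx'⟩
  -- some vertex of `K` is not a vertex of `K'`
  obtain ⟨i, hi⟩ : ∃ i, K.points i ∉ K'.verts := by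
    by_contra! hall
    refine hv (eq_of_subset_of_ncard_le (range_subset_iff.2 hall) ?_ (finite_range _))
    rw [K.ncard_verts, K'.ncard_verts]
  -- its barycentric coordinate vanishes on the hull of the common vertices
  have hsub : convexHull ℝ (K.verts ∩ K'.verts) ⊆ {y | K.bary i y = 0} := by
    refine convexHull_min ?_ ?_
    · rintro _ ⟨⟨j, rfl⟩, hj⟩
      have hij : i ≠ j := by rintro rfl; exact hi hj
      simp [K.bary_vert, hij]
    · exact (convex_singleton (0 : ℝ)).affine_preimage (K.basis.coord i)
  have h0 : K.bary i x = 0 := hsub hxc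
  rw [K.interior_carrier] at hx
  exact (hx i).ne' h0

/-- Near `y`, only the triangles containing `y` matter. -/
theorem IsRegularTriangulation.eventually_mem (hT : IsRegularTriangulation Ω T) (y : Plane) :
    ∀ᶠ z in 𝓝 y, ∀ K ∈ T, z ∈ K.carrier → y ∈ K.carrier := by
  refine (eventually_all_finite hT.finite).2 fun K _ => ?_
  by_cases hy : y ∈ K.carrier
  · exact .of_forall fun _ _ => hy
  · filter_upwards [K.isClosed_carrier.isOpen_compl.mem_nhds hy] with z hz hzK
    exact absurd hzK hz

end Triangulation

/-! ### The boundary near one of its points -/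

/-- The closed ray from `y` in the direction `d`. -/
def ray (y d : Plane) : Set Plane := {w | ∃ s : ℝ, 0 ≤ s ∧ w = y + s • d}

/-- The cross product in the plane. -/
def cross (d w : Plane) : ℝ := d 0 * w 1 - d 1 * w 0

theorem convex_ball_inter_halfPlane (y d : Plane) (r : ℝ) :
    Convex ℝ (ball y r ∩ {w | 0 < cross d (w - y)}) := by
  refine (convex_ball y r).inter fun u hu v hv a b ha hb hab => ?_
  have h : cross d (a • u + b • v - y) = a * cross d (u - y) + b * cross d (v - y) := by
    obtain rfl : b = 1 - a := by linarith
    simp [cross]; ring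
  simp only [mem_ofPred_eq] at hu hv ⊢
  rw [h]
  rcases ha.eq_or_lt with rfl | ha
  · obtain rfl : b = 1 := by linarith
    simpa using hv
  · have := mul_pos ha hu
    have := mul_nonneg hb hv.le
    linarith

theorem sq_add_sq_pos {d : Plane} (hd : d ≠ 0) : 0 < d 0 ^ 2 + d 1 ^ 2 := by
  by_contra hn
  refine hd (PiLp.ext fun i => ?_)
  fin_cases i <;> simp <;> nlinarith [sq_nonneg (d 0), sq_nonneg (d 1)]

/-- Vectors with vanishing cross product are parallel. -/
theorem eq_smul_of_cross {d v : Plane} (hd : d ≠ 0) (h : cross d v = 0) :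
    v = ((d 0 * v 0 + d 1 * v 1) / (d 0 ^ 2 + d 1 ^ 2)) • d := by
  have hn := sq_add_sq_pos hd
  have hn' := hn.ne'
  unfold cross at h
  refine PiLp.ext fun i => ?_
  fin_cases i <;> simp <;> field_simp
  · linear_combination (-d 1) * h
  · linear_combination (d 0) * h

/-- Cramer's rule in the plane. -/
theorem eq_smul_add_smul_of_cross {d e : Plane} (h : cross d e ≠ 0) (v : Plane) :
    v = (cross v e / cross d e) • d + (cross d v / cross d e) • e := by
  refine PiLp.ext fun i => ?_
  fin_cases i <;> simp <;> field_simp <;> simp [cross] <;> ring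

theorem cross_smul (d : Plane) (s : ℝ) (w : Plane) : cross d (s • w) = s * cross d w := by
  simp [cross]; ring

theorem cross_self (d : Plane) : cross d d = 0 := by simp [cross]; ring

theorem cross_swap (d w : Plane) : cross w d = -cross d w := by simp [cross]; ring

theorem cross_neg_left (d w : Plane) : cross (-d) w = -cross d w := by simp [cross]; ring

theorem exists_pos_smul_mem_ball (y d : Plane) {r : ℝ} (hr : 0 < r) :
    ∃ s : ℝ, 0 < s ∧ y + s • d ∈ ball y r := by
  refine ⟨r / (‖d‖ + 1), by positivity, ?_⟩
  rw [mem_ball, dist_eq_norm, add_sub_cancel_left, norm_smul, Real.norm_of_nonneg (by positivity),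
    div_mul_eq_mul_div, div_lt_iff₀ (by positivity)]
  nlinarith [norm_nonneg d]

/-- Two rays of independent directions divide a disc into two connected sectors. -/
theorem exists_sectors_of_cross_pos {y d e : Plane} {r : ℝ} (hr : 0 < r) (hc : 0 < cross d e) :
    ∃ A B : Set Plane, IsPreconnected A ∧ IsPreconnected B ∧
      ball y r \ (ray y d ∪ ray y e) = A ∪ B := by
  refine ⟨(ball y r ∩ {w | 0 < cross d (w - y)}) ∩ (ball y r ∩ {w | 0 < cross (-e) (w - y)}),
    (ball y r ∩ {w | 0 < cross (-d) (w - y)}) ∪ (ball y r ∩ {w | 0 < cross e (w - y)}),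
    ((convex_ball_inter_halfPlane y d r).inter
      (convex_ball_inter_halfPlane y (-e) r)).isPreconnected, ?_, ?_⟩
  · -- the two half discs meet in a point in the direction `-(d + e)`
    obtain ⟨s, hs, hsb⟩ := exists_pos_smul_mem_ball y (-(d + e)) hr
    refine IsPreconnected.union (y + s • -(d + e)) ⟨hsb, ?_⟩ ⟨hsb, ?_⟩
      (convex_ball_inter_halfPlane y (-d) r).isPreconnected
      (convex_ball_inter_halfPlane y e r).isPreconnected
    all_goals
      have := mul_pos hs hc
      simp only [mem_ofPred_eq, cross] at this ⊢
      simp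
      nlinarith
  · ext w
    have hrep := eq_smul_add_smul_of_cross hc.ne' (w - y)
    simp only [Set.mem_sdiff, mem_union, mem_inter_iff, mem_ofPred_eq, cross_neg_left]
    constructor
    · rintro ⟨hwb, hw⟩
      by_contra hcon
      push Not at hw hcon
      have h1 : 0 ≤ cross d (w - y) := by
        by_contra h; exact hcon.2.1 hwb |>.not_gt (by linarith)
      have h2 : 0 ≤ cross (w - y) e := by
        rw [cross_swap]; have := hcon.2.2 hwb; linarith
      rcases h1.eq_or_lt with h1 | h1
      · refine hw.1 ⟨cross (w - y) e / cross d e, by positivity, ?_⟩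
        rw [← h1, zero_div, zero_smul, add_zero] at hrep
        rw [← hrep]; abel
      · rcases h2.eq_or_lt with h2 | h2
        · refine hw.2 ⟨cross d (w - y) / cross d e, by positivity, ?_⟩
          rw [← h2, zero_div, zero_smul, zero_add] at hrep
          rw [← hrep]; abel
        · have := hcon.1 ⟨hwb, h1⟩ hwb
          rw [cross_swap] at h2
          linarith
    · intro h
      have hwb : w ∈ ball y r := by tauto
      refine ⟨hwb, ?_⟩
      rintro (⟨s, hs, rfl⟩ | ⟨s, hs, rfl⟩)
      all_goals
        simp only [add_sub_cancel_left, cross_smul, cross_self, cross_swap d e] at h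
        have := mul_nonneg hs hc.le
        rcases h with ⟨⟨-, h⟩, -, h'⟩ | ⟨-, h⟩ | ⟨-, h⟩ <;> linarith

/-- Two rays from a common point divide a disc into at most two connected sectors. -/
theorem exists_sectors {y d e : Plane} {r : ℝ} (hr : 0 < r) (hd : d ≠ 0) (he : e ≠ 0) :
    ∃ A B : Set Plane, IsPreconnected A ∧ IsPreconnected B ∧
      ball y r \ (ray y d ∪ ray y e) = A ∪ B := by
  rcases lt_trichotomy (cross d e) 0 with hc | hc | hc
  · rw [union_comm (ray y d)]
    exact exists_sectors_of_cross_pos hr (by rw [cross_swap]; linarith)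
  · have hn := sq_add_sq_pos hd
    set l := (d 0 * e 0 + d 1 * e 1) / (d 0 ^ 2 + d 1 ^ 2) with hl
    have hel : e = l • d := eq_smul_of_cross hd hc
    have hl0 : l ≠ 0 := by
      intro h0; rw [h0, zero_smul] at hel; exact he hel
    rcases hl0.lt_or_gt with hneg | hpos
    · -- opposite rays form a line, which leaves two half discs
      refine ⟨_, _, (convex_ball_inter_halfPlane y d r).isPreconnected,
        (convex_ball_inter_halfPlane y (-d) r).isPreconnected, ?_⟩
      ext w
      simp only [Set.mem_sdiff, mem_union, mem_inter_iff, mem_ofPred_eq, cross_neg_left]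
      constructor
      · rintro ⟨hwb, hw⟩
        rcases lt_trichotomy (cross d (w - y)) 0 with h | h | h
        · exact .inr ⟨hwb, by linarith⟩
        · have hrep := eq_smul_of_cross hd h
          set m := (d 0 * (w - y) 0 + d 1 * (w - y) 1) / (d 0 ^ 2 + d 1 ^ 2)
          refine absurd ?_ hw
          rcases le_or_gt 0 m with hm | hm
          · exact .inl ⟨m, hm, by rw [← hrep]; abel⟩
          · refine .inr ⟨m / l, (div_pos_of_neg_of_neg hm hneg).le, ?_⟩
            rw [hel, smul_smul, div_mul_cancel₀ _ hl0, ← hrep]; abel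
        · exact .inl ⟨hwb, h⟩
      · intro h
        refine ⟨by tauto, ?_⟩
        rintro (⟨s, hs, rfl⟩ | ⟨s, hs, rfl⟩) <;>
        simp [cross_smul, cross_self, hc] at h
    · -- equal rays leave a slit disc, the union of three half discs
      obtain ⟨p, hp⟩ : ∃ p : Plane, p = !₂[-(d 1), d 0] := ⟨_, rfl⟩
      have hp0 : p 0 = -(d 1) := by rw [hp]; rfl
      have hp1 : p 1 = d 0 := by rw [hp]; rfl
      refine ⟨((ball y r ∩ {w | 0 < cross d (w - y)}) ∪ (ball y r ∩ {w | 0 < cross p (w - y)})) ∪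
        (ball y r ∩ {w | 0 < cross (-d) (w - y)}), ∅, ?_, isPreconnected_empty, ?_⟩
      · obtain ⟨s, hs, hsb⟩ := exists_pos_smul_mem_ball y (-d + p) hr
        obtain ⟨s', hs', hsb'⟩ := exists_pos_smul_mem_ball y (-d - p) hr
        have h1 := mul_pos hs hn
        have h2 := mul_pos hs' hn
        refine IsPreconnected.union (y + s' • (-d - p)) (.inr ⟨hsb', ?_⟩) ⟨hsb', ?_⟩
          (IsPreconnected.union (y + s • (-d + p)) ⟨hsb, ?_⟩ ⟨hsb, ?_⟩
            (convex_ball_inter_halfPlane y d r).isPreconnected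
            (convex_ball_inter_halfPlane y p r).isPreconnected)
          (convex_ball_inter_halfPlane y (-d) r).isPreconnected
        all_goals
          simp only [mem_ofPred_eq, cross]
          simp [hp0, hp1]
          nlinarith
      · ext w
        simp only [Set.mem_sdiff, mem_union, mem_inter_iff, mem_ofPred_eq, cross_neg_left,
          mem_empty_iff_false, or_false]
        constructor
        · rintro ⟨hwb, hw⟩
          rcases lt_trichotomy (cross d (w - y)) 0 with h | h | h
          · exact .inr ⟨hwb, by linarith⟩
          · have hrep := eq_smul_of_cross hd h
            set m := (d 0 * (w - y) 0 + d 1 * (w - y) 1) / (d 0 ^ 2 + d 1 ^ 2)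
            rcases le_or_gt 0 m with hm | hm
            · exact absurd (.inl ⟨m, hm, by rw [← hrep]; abel⟩) hw
            · refine .inl (.inr ⟨hwb, ?_⟩)
              have := mul_pos_of_neg_of_neg hm (neg_lt_zero.2 hn)
              rw [hrep, cross, PiLp.smul_apply, PiLp.smul_apply, hp0, hp1, smul_eq_mul, smul_eq_mul]
              linarith
          · exact .inl (.inl ⟨hwb, h⟩)
        · intro h
          refine ⟨by tauto, ?_⟩
          have hpd : ∀ s : ℝ, 0 ≤ s → ¬ 0 < cross p (s • d) := by
            intro s hs
            have := mul_nonneg hs hn.le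
            rw [cross, PiLp.smul_apply, PiLp.smul_apply, hp0, hp1, smul_eq_mul, smul_eq_mul]
            linarith
          rintro (⟨s, hs, rfl⟩ | ⟨s, hs, rfl⟩)
          · simp only [add_sub_cancel_left, cross_smul d, cross_self, mul_zero, neg_zero,
              lt_irrefl, and_false, false_or, or_false] at h
            exact hpd s hs h.2
          · simp only [add_sub_cancel_left, cross_smul d, hc, mul_zero, neg_zero,
              lt_irrefl, and_false, false_or, or_false] at h
            rw [hel, smul_smul] at h
            exact hpd _ (mul_nonneg hs hpos.le) h.2
  · exact exists_sectors_of_cross_pos hr hc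

theorem segment_subset_ray (y p : Plane) : segment ℝ y p ⊆ ray y (p - y) := by
  rw [segment_eq_image']
  rintro _ ⟨s, hs, rfl⟩
  exact ⟨s, hs.1, rfl⟩

theorem eventually_mem_segment_of_mem_ray {y p : Plane} (hp : p ≠ y) :
    ∀ᶠ w in 𝓝 y, w ∈ ray y (p - y) → w ∈ segment ℝ y p := by
  have hn : 0 < ‖p - y‖ := norm_pos_iff.2 (sub_ne_zero.2 hp)
  filter_upwards [ball_mem_nhds y hn] with w hw
  rintro ⟨s, hs, rfl⟩
  rw [mem_ball, dist_eq_norm, add_sub_cancel_left, norm_smul, Real.norm_of_nonneg hs] at hw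
  rw [segment_eq_image']
  exact ⟨s, ⟨hs, by nlinarith⟩, rfl⟩

/-- Near each of its points, the boundary of a polygonal domain consists of two rays. -/
theorem IsPolygonalDomain.exists_rays {Ω : Set Plane} (hΩ : IsPolygonalDomain Ω) {y : Plane}
    (hy : y ∈ frontier Ω) : ∃ d e : Plane, d ≠ 0 ∧ e ≠ 0 ∧
      ∀ᶠ w in 𝓝 y, (w ∈ frontier Ω ↔ w ∈ ray y d ∪ ray y e) := by
  obtain ⟨B, hBf, hB2, hBi, hBv, hB⟩ := hΩ.boundary
  have hseg : ∀ e ∈ B, IsClosed (convexHull ℝ e) := fun e he =>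
    ((finite_of_ncard_ne_zero (by rw [hB2 e he]; norm_num)).isCompact_convexHull
      (𝕜 := ℝ)).isClosed
  have hloc : ∀ᶠ w in 𝓝 y, ∀ e ∈ B, w ∈ convexHull ℝ e → y ∈ convexHull ℝ e := by
    refine (eventually_all_finite hBf).2 fun e he => ?_
    by_cases hye : y ∈ convexHull ℝ e
    · exact .of_forall fun _ _ => hye
    · filter_upwards [(hseg e he).isOpen_compl.mem_nhds hye] with z hz hz'
      exact absurd hz' hz
  have hy' := hy
  rw [hB] at hy'
  simp only [mem_iUnion, exists_prop] at hy'
  by_cases hv : ∃ e ∈ B, y ∈ e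
  · -- `y` is a corner: exactly two edges contain it
    obtain ⟨e₀, he₀, hye₀⟩ := hv
    have hcont : ∀ e ∈ B, y ∈ convexHull ℝ e → y ∈ e := by
      intro e he hye
      by_contra hne
      have h1 : y ∈ convexHull ℝ (e₀ ∩ e) := by
        rw [← hBi e₀ he₀ e he]; exact ⟨subset_convexHull _ _ hye₀, hye⟩
      obtain ⟨a, b, hab, rfl⟩ := ncard_eq_two.1 (hB2 e₀ he₀)
      obtain ⟨c, hc⟩ : ∃ c, c ≠ y ∧ ({a, b} : Set Plane) ⊆ {y, c} := by
        rcases hye₀ with rfl | rfl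
        · exact ⟨b, hab.symm, subset_rfl⟩
        · exact ⟨a, hab, by rw [pair_comm]⟩
      have h2 : ({a, b} : Set Plane) ∩ e ⊆ {c} := by
        rintro z ⟨hz, hze⟩
        rcases hc.2 hz with rfl | h
        · exact absurd hze hne
        · exact h
      have h3 := convexHull_mono (𝕜 := ℝ) h2 h1
      rw [convexHull_singleton] at h3
      exact hc.1 h3.symm
    obtain ⟨e₁, e₂, h12, hset⟩ := ncard_eq_two.1 (hBv e₀ he₀ y hye₀)
    have hother : ∀ e ∈ B, y ∈ e → ∃ p, p ≠ y ∧ convexHull ℝ e = segment ℝ y p := by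
      intro e he hye
      obtain ⟨a, b, hab, rfl⟩ := ncard_eq_two.1 (hB2 e he)
      rcases hye with rfl | rfl
      · exact ⟨b, hab.symm, convexHull_pair _ _⟩
      · exact ⟨a, hab, by rw [convexHull_pair, segment_symm]⟩
    have h1 : e₁ ∈ {e' ∈ B | y ∈ e'} := by rw [hset]; simp
    have h2 : e₂ ∈ {e' ∈ B | y ∈ e'} := by rw [hset]; simp
    obtain ⟨p, hp, hpe⟩ := hother e₁ h1.1 h1.2
    obtain ⟨q, hq, hqe⟩ := hother e₂ h2.1 h2.2
    refine ⟨p - y, q - y, sub_ne_zero.2 hp, sub_ne_zero.2 hq, ?_⟩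
    filter_upwards [hloc, eventually_mem_segment_of_mem_ray hp,
      eventually_mem_segment_of_mem_ray hq] with w hw hwp hwq
    rw [hB]
    simp only [mem_iUnion, exists_prop]
    constructor
    · rintro ⟨e, he, hwe⟩
      have : e ∈ {e' ∈ B | y ∈ e'} := ⟨he, hcont e he (hw e he hwe)⟩
      rw [hset] at this
      rcases this with rfl | rfl
      · exact .inl (segment_subset_ray _ _ (hpe ▸ hwe))
      · exact .inr (segment_subset_ray _ _ (hqe ▸ hwe))
    · rintro (h | h)
      · exact ⟨e₁, h1.1, hpe ▸ hwp h⟩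
      · exact ⟨e₂, h2.1, hqe ▸ hwq h⟩
  · -- `y` lies inside a unique edge
    push Not at hv
    obtain ⟨e₀, he₀, hye₀⟩ := hy'
    have huniq : ∀ e ∈ B, y ∈ convexHull ℝ e → e = e₀ := by
      intro e he hye
      by_contra hne
      have h1 : y ∈ convexHull ℝ (e₀ ∩ e) := by
        rw [← hBi e₀ he₀ e he]; exact ⟨hye₀, hye⟩
      have hsub : (e₀ ∩ e).Subsingleton := by
        have hfin : e₀.Finite := finite_of_ncard_ne_zero (by rw [hB2 e₀ he₀]; norm_num)
        have hfin' : e.Finite := finite_of_ncard_ne_zero (by rw [hB2 e he]; norm_num)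
        by_contra hns
        have h2 : 1 < (e₀ ∩ e).ncard :=
          (one_lt_ncard (hfin.inter_of_left e)).2 (not_subsingleton_iff.1 hns)
        have h3 := eq_of_subset_of_ncard_le (inter_subset_left (s := e₀) (t := e))
          (by rw [hB2 e₀ he₀]; omega) hfin
        have h4 := eq_of_subset_of_ncard_le (inter_subset_right (s := e₀) (t := e))
          (by rw [hB2 e he]; omega) hfin'
        exact hne (h4.symm.trans h3)
      rcases hsub.eq_empty_or_singleton with h | ⟨z, h⟩
      · rw [h] at h1; simp at h1
      · rw [h, convexHull_singleton] at h1
        have : z ∈ e₀ ∩ e := by rw [h]; rfl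
        exact hv e₀ he₀ (h1 ▸ this.1)
    obtain ⟨p, q, hpq, rfl⟩ := ncard_eq_two.1 (hB2 e₀ he₀)
    have hp : p ≠ y := by rintro rfl; exact hv _ he₀ (by simp)
    have hq : q ≠ y := by rintro rfl; exact hv _ he₀ (by simp)
    rw [convexHull_pair] at hye₀
    refine ⟨p - y, q - y, sub_ne_zero.2 hp, sub_ne_zero.2 hq, ?_⟩
    filter_upwards [hloc, eventually_mem_segment_of_mem_ray hp,
      eventually_mem_segment_of_mem_ray hq] with w hw hwp hwq
    rw [hB]
    simp only [mem_iUnion, exists_prop]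
    constructor
    · rintro ⟨e, he, hwe⟩
      obtain rfl := huniq e he (hw e he hwe)
      rw [convexHull_pair] at hwe
      rw [segment_eq_image'] at hwe hye₀
      obtain ⟨t, ht, rfl⟩ := hye₀
      obtain ⟨s, hs, rfl⟩ := hwe
      have ht0 : t ≠ 0 := by rintro rfl; simp at hp
      have ht1 : 1 - t ≠ 0 := by
        intro h; obtain rfl : t = 1 := by linarith
        simp at hq
      have ht0' : 0 < t := lt_of_le_of_ne ht.1 ht0.symm
      have ht1' : 0 < 1 - t := lt_of_le_of_ne (by linarith [ht.2]) ht1.symm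
      rcases le_total s t with h | h
      · refine .inl ⟨(t - s) / t, div_nonneg (by linarith) ht0'.le, ?_⟩
        have : p - (p + t • (q - p)) = (-t) • (q - p) := by module
        rw [this, smul_smul]
        have h2 : (t - s) / t * -t = s - t := by field_simp; ring
        rw [h2]
        module
      · refine .inr ⟨(s - t) / (1 - t), div_nonneg (by linarith) ht1'.le, ?_⟩
        have : q - (p + t • (q - p)) = (1 - t) • (q - p) := by module
        rw [this, smul_smul, div_mul_cancel₀ _ ht1]
        module
    · have hconv := convex_segment (𝕜 := ℝ) p q
      rintro (h | h)
      · exact ⟨_, he₀, by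
          rw [convexHull_pair]
          exact hconv.segment_subset hye₀ (left_mem_segment ℝ p q) (hwp h)⟩
      · exact ⟨_, he₀, by
          rw [convexHull_pair]
          exact hconv.segment_subset hye₀ (right_mem_segment ℝ p q) (hwq h)⟩

/-- A polygonal domain is locally connected at its boundary: it does not touch itself in a corner,
and it lies on one side of its edges. -/
theorem IsPolygonalDomain.eventually_isPreconnected {Ω : Set Plane} (hΩ : IsPolygonalDomain Ω)
    (y : Plane) : ∀ᶠ r in 𝓝[>] (0 : ℝ), IsPreconnected (ball y r ∩ Ω) := by
  by_cases hyf : y ∈ frontier Ω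
  · -- two rays cut a small disc into at most two sectors, which do not both lie in `Ω`
    obtain ⟨d, e, hd, he, hde⟩ := hΩ.exists_rays hyf
    obtain ⟨δ, hδ, hball⟩ := Metric.eventually_nhds_iff_ball.1 hde
    filter_upwards [Ioo_mem_nhdsGT hδ] with r hr
    obtain ⟨A, B, hA, hB, hAB⟩ := exists_sectors (y := y) hr.1 hd he
    have hfr : ball y r \ frontier Ω = A ∪ B := by
      rw [← hAB]
      ext w
      simp only [Set.mem_sdiff]
      exact and_congr_right fun hw => not_congr (hball w (ball_subset_ball hr.2.le hw))
    have hdich : ∀ S, IsPreconnected S → S ∩ frontier Ω = ∅ → S ⊆ Ω ∨ S ∩ Ω = ∅ := by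
      intro S hS hSf
      have hcov : S ⊆ Ω ∪ (closure Ω)ᶜ := by
        intro z hz
        by_cases hzc : z ∈ closure Ω
        · left
          by_contra hzΩ
          have : z ∈ S ∩ frontier Ω := ⟨hz, hzc, by rwa [hΩ.isOpen.interior_eq]⟩
          rw [hSf] at this
          exact this
        · exact .inr hzc
      have hdisj : Disjoint Ω (closure Ω)ᶜ :=
        disjoint_compl_right.mono_left subset_closure
      rcases hS.subset_or_subset hΩ.isOpen isClosed_closure.isOpen_compl hdisj hcov with h | h
      · exact .inl h
      · right
        exact disjoint_iff_inter_eq_empty.1 (hdisj.symm.mono_left h)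
    have hAf : A ∩ frontier Ω = ∅ := by
      ext z; simp only [mem_inter_iff, mem_empty_iff_false, iff_false]
      rintro ⟨h1, h2⟩
      exact (hfr.symm ▸ (.inl h1 : z ∈ A ∪ B) : z ∈ ball y r \ frontier Ω).2 h2
    have hBf : B ∩ frontier Ω = ∅ := by
      ext z; simp only [mem_inter_iff, mem_empty_iff_false, iff_false]
      rintro ⟨h1, h2⟩
      exact (hfr.symm ▸ (.inr h1 : z ∈ A ∪ B) : z ∈ ball y r \ frontier Ω).2 h2
    have hΩAB : ball y r ∩ Ω = (A ∩ Ω) ∪ (B ∩ Ω) := by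
      rw [← union_inter_distrib_right, ← hfr]
      ext z
      constructor
      · rintro ⟨h1, h2⟩
        refine ⟨⟨h1, fun h3 => ?_⟩, h2⟩
        rw [hΩ.isOpen.frontier_eq] at h3
        exact h3.2 h2
      · rintro ⟨⟨h1, -⟩, h2⟩
        exact ⟨h1, h2⟩
    rw [hΩAB]
    rcases hdich A hA hAf with h1 | h1 <;> rcases hdich B hB hBf with h2 | h2
    · -- otherwise the whole disc would lie in the closure of the domain
      exfalso
      have hsub : ball y r ⊆ closure Ω := by
        intro z hz
        by_cases hzf : z ∈ frontier Ω
        · exact frontier_subset_closure hzf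
        · have : z ∈ A ∪ B := hfr ▸ ⟨hz, hzf⟩
          exact subset_closure (union_subset h1 h2 this)
      have hyi : y ∈ interior (closure Ω) :=
        mem_interior.2 ⟨ball y r, hsub, isOpen_ball, mem_ball_self hr.1⟩
      rw [hΩ.one_sided] at hyi
      rw [hΩ.isOpen.frontier_eq] at hyf
      exact hyf.2 hyi
    · rw [h2, union_empty, inter_eq_left.2 h1]; exact hA
    · rw [h1, empty_union, inter_eq_left.2 h2]; exact hB
    · rw [h1, h2, empty_union]; exact isPreconnected_empty
  · by_cases hyΩ : y ∈ Ω
    · obtain ⟨δ, hδ, hball⟩ := Metric.isOpen_iff.1 hΩ.isOpen y hyΩ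
      filter_upwards [Ioo_mem_nhdsGT hδ] with r hr
      rw [inter_eq_left.2 ((ball_subset_ball hr.2.le).trans hball)]
      exact (convex_ball y r).isPreconnected
    · have : y ∉ closure Ω := fun h => hyf ⟨h, by rwa [hΩ.isOpen.interior_eq]⟩
      obtain ⟨δ, hδ, hball⟩ := Metric.isOpen_iff.1 isClosed_closure.isOpen_compl y this
      filter_upwards [Ioo_mem_nhdsGT hδ] with r hr
      have : ball y r ∩ Ω = ∅ := by
        ext z; simp only [mem_inter_iff, mem_empty_iff_false, iff_false]
        rintro ⟨h1, h2⟩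
        exact hball (ball_subset_ball hr.2.le h1) (subset_closure h2)
      rw [this]
      exact isPreconnected_empty

/-! ### Continuity and potentials of piecewise polynomials -/

section Continuity

variable {Ω : Set Plane} {T : Set Triangle}

/-- If a piecewise polynomial is continuous inside the domain, then it is continuous up to the
boundary: near a boundary point `y`, the value at `y` of the polynomial on the triangle through `z`
is locally constant in `z`, and the domain is connected near `y`. -/
theorem IsRegularTriangulation.val_eq_of_mem (hT : IsRegularTriangulation Ω T)
    (hΩ : IsPolygonalDomain Ω) {p : Triangle → Poly}
    (hloc : ∀ y ∈ Ω, ∀ K ∈ T, ∀ K' ∈ T, y ∈ K.carrier → y ∈ K'.carrier →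
      val (p K) y = val (p K') y)
    {K K' : Triangle} (hK : K ∈ T) (hK' : K' ∈ T) {y : Plane} (hy : y ∈ K.carrier)
    (hy' : y ∈ K'.carrier) : val (p K) y = val (p K') y := by
  obtain ⟨δ, hδ, hball⟩ := Metric.eventually_nhds_iff_ball.1 (hT.eventually_mem y)
  obtain ⟨r, hpre, hr0, hrδ⟩ := ((hΩ.eventually_isPreconnected y).and
    (Ioo_mem_nhdsGT hδ)).exists
  have hmem : ∀ z ∈ ball y r, ∀ K ∈ T, z ∈ K.carrier → y ∈ K.carrier := fun z hz =>
    hball z (ball_subset_ball hrδ.le hz)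
  -- the domain is star-shaped near `y`, except that `y` itself may be missing
  have hstar : ∀ z ∈ ball y r ∩ Ω, ∀ t ∈ Ioc (0 : ℝ) 1, y + t • (z - y) ∈ Ω := by
    rintro z hz t ⟨ht0, ht1⟩
    rw [← hΩ.one_sided, mem_interior_iff_mem_nhds]
    have hcont : ContinuousAt (fun u : Plane => y + t⁻¹ • (u - y)) (y + t • (z - y)) := by
      fun_prop
    have hval : y + t⁻¹ • (y + t • (z - y) - y) = z := by
      rw [add_sub_cancel_left, smul_smul, inv_mul_cancel₀ ht0.ne', one_smul]
      abel
    have hnhds : ball y r ∩ Ω ∈ 𝓝 (y + t⁻¹ • (y + t • (z - y) - y)) := by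
      rw [hval]; exact (isOpen_ball.inter hΩ.isOpen).mem_nhds hz
    filter_upwards [hcont.preimage_mem_nhds hnhds] with u hu
    obtain ⟨L, hL, huL⟩ := hT.exists_mem (subset_closure hu.2)
    refine hT.carrier_subset hL ?_
    have := L.convex_carrier.add_smul_sub_mem (hmem _ hu.1 L hL huL) huL ⟨ht0.le, ht1⟩
    simpa [smul_smul, mul_inv_cancel₀ ht0.ne'] using this
  have hwd : ∀ z ∈ ball y r ∩ Ω, ∀ K ∈ T, ∀ K' ∈ T, z ∈ K.carrier → z ∈ K'.carrier →
      val (p K) y = val (p K') y := by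
    intro z hz K hK K' hK' hzK hzK'
    have hseg : Tendsto (fun t : ℝ => y + t • (z - y)) (𝓝[>] 0) (𝓝 y) := by
      have : ContinuousAt (fun t : ℝ => y + t • (z - y)) 0 := by fun_prop
      simpa [ContinuousAt] using this.tendsto.mono_left (nhdsWithin_le_nhds (s := Ioi 0))
    refine tendsto_nhds_unique_of_eventuallyEq
      (((continuous_val (p K)).tendsto y).comp hseg)
      (((continuous_val (p K')).tendsto y).comp hseg) ?_
    filter_upwards [Ioc_mem_nhdsGT one_pos] with t ht
    exact hloc _ (hstar z hz t ht) K hK K' hK'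
      (K.convex_carrier.add_smul_sub_mem (hmem z hz.1 K hK hzK) hzK ⟨ht.1.le, ht.2⟩)
      (K'.convex_carrier.add_smul_sub_mem (hmem z hz.1 K' hK' hzK') hzK' ⟨ht.1.le, ht.2⟩)
  have hex : ∀ z : (ball y r ∩ Ω : Set Plane), ∃ K ∈ T, (z : Plane) ∈ K.carrier := fun z =>
    hT.exists_mem (subset_closure z.2.2)
  choose L hL hzL using hex
  have : PreconnectedSpace (ball y r ∩ Ω : Set Plane) :=
    isPreconnected_iff_preconnectedSpace.1 hpre
  have hlc : IsLocallyConstant fun z : (ball y r ∩ Ω : Set Plane) => val (p (L z)) y := by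
    rw [IsLocallyConstant.iff_eventually_eq]
    intro z
    filter_upwards [continuous_subtype_val.continuousAt.eventually (hT.eventually_mem (z : Plane))]
      with z' hz'
    exact hwd z z.2 _ (hL _) _ (hL _) (hz' _ (hL _) (hzL z')) (hzL z)
  have hpt : ∀ K ∈ T, y ∈ K.carrier →
      ∃ z : (ball y r ∩ Ω : Set Plane), (z : Plane) ∈ K.carrier := by
    intro K hK hy
    obtain ⟨z, hzb, hzK⟩ := mem_closure_iff.1 (K.subset_closure_interior hy) _ isOpen_ball
      (mem_ball_self hr0)
    exact ⟨⟨z, hzb, hT.interior_carrier_subset hΩ hK hzK⟩, interior_subset hzK⟩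
  obtain ⟨z, hz⟩ := hpt K hK hy
  obtain ⟨z', hz'⟩ := hpt K' hK' hy'
  rw [hwd z z.2 K hK _ (hL z) hz (hzL z), hwd z' z'.2 K' hK' _ (hL z') hz' (hzL z')]
  exact hlc.apply_eq_of_preconnectedSpace z z'

/-- The value of a continuous function at a point of a closed triangle is determined by its values
inside the triangle. -/
theorem eq_val_of_continuousAt {F : Plane → ℝ} {y : Plane} (hF : ContinuousAt F y) {K : Triangle}
    (hy : y ∈ K.carrier) {p : Poly}
    (h : ∀ᶠ x in 𝓝 y, x ∈ interior K.carrier → F x = val p x) : F y = val p y := by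
  have : (𝓝[interior K.carrier] y).NeBot :=
    mem_closure_iff_nhdsWithin_neBot.1 (K.subset_closure_interior hy)
  refine tendsto_nhds_unique_of_eventuallyEq (l := 𝓝[interior K.carrier] y)
    (hF.mono_left nhdsWithin_le_nhds)
    (((continuous_val p).tendsto y).mono_left nhdsWithin_le_nhds) ?_
  filter_upwards [self_mem_nhdsWithin, nhdsWithin_le_nhds h] with x hx hx' using hx' hx

theorem exists_bound_val (hT : T.Finite) (p : Triangle → Poly) :
    ∃ M : NNReal, ∀ K ∈ T, ∀ x ∈ K.carrier, |val (p K) x| ≤ M := by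
  have hK : ∀ K : Triangle, ∃ M : ℝ, ∀ x ∈ K.carrier, |val (p K) x| ≤ M := fun K =>
    K.isCompact_carrier.exists_bound_of_continuousOn (continuous_val (p K)).continuousOn
  choose M hM using hK
  obtain ⟨C, hC⟩ := (hT.image M).bddAbove
  refine ⟨C.toNNReal, fun K hK x hx => ?_⟩
  exact (hM K x hx).trans ((hC ⟨K, hK, rfl⟩).trans (Real.le_coe_toNNReal C))

theorem ae_interior_of_ae_restrict {K : Triangle} {P : Plane → Prop}
    (h : ∀ᵐ x ∂volume.restrict K.carrier, P x) : ∀ᵐ x, x ∈ interior K.carrier → P x := by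
  filter_upwards [(ae_restrict_iff' K.isClosed_carrier.measurableSet).1 h] with x hx hxK
  exact hx (interior_subset hxK)

theorem ae_restrict_of_interior {K : Triangle} {P : Plane → Prop}
    (h : ∀ x, x ∈ interior K.carrier → P x) : ∀ᵐ x ∂volume.restrict K.carrier, P x := by
  rw [ae_restrict_iff' K.isClosed_carrier.measurableSet]
  filter_upwards [K.ae_mem_interior] with x hx hxK using h x (hx hxK)

/-- A bound on the pieces of a piecewise polynomial is a bound almost everywhere. -/
theorem IsRegularTriangulation.exists_ae_bound (hT : IsRegularTriangulation Ω T)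
    {F : Plane → ℝ} {p : Triangle → Poly}
    (h : ∀ K ∈ T, ∀ᵐ x, x ∈ interior K.carrier → F x = val (p K) x) :
    ∃ M : NNReal, ∀ᵐ x, x ∈ Ω → |F x| ≤ M := by
  obtain ⟨M, hM⟩ := exists_bound_val hT.finite p
  refine ⟨M, ?_⟩
  filter_upwards [hT.ae_exists_interior, (ae_ball_iff hT.finite.countable).2 h] with x hx hx' hxΩ
  obtain ⟨K, hK, hxK⟩ := hx hxΩ
  rw [hx' K hK hxK]
  exact hM K hK x (interior_subset hxK)

theorem IsL2.integrable_indicator (hΩ : IsPolygonalDomain Ω) {u : Plane → ℝ} (h : IsL2 Ω u) :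
    Integrable (Ω.indicator u) := by
  have : IsFiniteMeasure (volume.restrict Ω) :=
    ⟨by rw [Measure.restrict_apply_univ]; exact hΩ.isBounded.measure_lt_top⟩
  rw [integrable_indicator_iff hΩ.isOpen.measurableSet]
  exact h.integrable one_le_two

theorem IsRegularTriangulation.isL2 (hT : IsRegularTriangulation Ω T) (hΩ : IsPolygonalDomain Ω)
    {F : Plane → ℝ} (hF : ContinuousOn F Ω) {p : Triangle → Poly}
    (h : ∀ K ∈ T, ∀ x ∈ interior K.carrier, F x = val (p K) x) : IsL2 Ω F := by
  have : IsFiniteMeasure (volume.restrict Ω) :=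
    ⟨by rw [Measure.restrict_apply_univ]; exact hΩ.isBounded.measure_lt_top⟩
  obtain ⟨M, hM⟩ := hT.exists_ae_bound (F := F) fun K hK => .of_forall (h K hK)
  exact MemLp.of_bound (hF.aestronglyMeasurable hΩ.isOpen.measurableSet) M
    ((ae_restrict_iff' hΩ.isOpen.measurableSet).2 hM)

theorem setIntegral_mul_eq_integral {ψ : Plane → ℝ} (h : ∀ x, x ∉ Ω → ψ x = 0)
    (u : Plane → ℝ) : ∫ x in Ω, u x * ψ x = ∫ x, u x * ψ x :=
  setIntegral_eq_integral_of_forall_compl_eq_zero fun x hx => by rw [h x hx, mul_zero]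

theorem HasWeakPartial.of_weakGrad {u : Plane → ℝ} {g : Fin 2 → Plane → ℝ} (h : WeakGrad Ω u g)
    (hu : IsL2 Ω u) (i : Fin 2) (hg : IsL2 Ω (g i)) : HasWeakPartial Ω i u (g i) := by
  refine ⟨hu, hg, fun ψ hψ => ?_⟩
  rw [setIntegral_mul_eq_integral (fun x hx => hψ.partialDeriv_eq_zero i hx),
    setIntegral_mul_eq_integral (fun x hx => hψ.eq_zero hx)]
  exact h i ψ hψ

theorem weakGrad_of_hasWeakPartial {u : Plane → ℝ} {g : Fin 2 → Plane → ℝ}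
    (h : ∀ i, HasWeakPartial Ω i u (g i)) : WeakGrad Ω u g := by
  intro i ψ hψ
  have := (h i).2.2 ψ hψ
  rwa [setIntegral_mul_eq_integral (fun x hx => hψ.partialDeriv_eq_zero i hx),
    setIntegral_mul_eq_integral (fun x hx => hψ.eq_zero hx)] at this

/-- Weak gradients are unique. -/
theorem WeakGrad.ae_eq {U : Set Plane} (hU : IsOpen U) {u : Plane → ℝ} {g g' : Fin 2 → Plane → ℝ}
    (h : WeakGrad U u g) (h' : WeakGrad U u g') (hg : ∀ i, LocallyIntegrable (g i))
    (hg' : ∀ i, LocallyIntegrable (g' i)) (i : Fin 2) : ∀ᵐ x, x ∈ U → g i x = g' i x := by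
  have hae : ∀ᵐ x, x ∈ U → g i x - g' i x = 0 := by
    refine hU.ae_eq_zero_of_integral_contDiff_smul_eq_zero
      (((hg i).sub (hg' i)).locallyIntegrableOn _) fun ψ h1 h2 h3 => ?_
    have e1 := h i ψ ⟨h1, h2, h3⟩
    have e2 := h' i ψ ⟨h1, h2, h3⟩
    rw [e1, neg_inj] at e2
    simp_rw [smul_eq_mul, mul_comm (ψ _), sub_mul]
    rw [integral_sub, e2, sub_self]
    · exact integrable_mul_of_hasCompactSupport (hg i) h1.continuous h2
    · exact integrable_mul_of_hasCompactSupport (hg' i) h1.continuous h2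
  filter_upwards [hae] with x hx hxU using sub_eq_zero.1 (hx hxU)

/-- A piecewise polynomial in `H¹` is continuous: its weak gradient is bounded, so it is locally
Lipschitz. -/
theorem IsRegularTriangulation.val_eq_of_mem_H1 (hT : IsRegularTriangulation Ω T)
    (hΩ : IsPolygonalDomain Ω) {u : Plane → ℝ} (hu : u ∈ H1 Ω) {p : Triangle → Poly}
    (hp : ∀ K ∈ T, ∀ᵐ x, x ∈ interior K.carrier → u x = val (p K) x)
    {K K' : Triangle} (hK : K ∈ T) (hK' : K' ∈ T) {y : Plane} (hy : y ∈ K.carrier)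
    (hy' : y ∈ K'.carrier) : val (p K) y = val (p K') y := by
  refine hT.val_eq_of_mem hΩ (fun y hyΩ => ?_) hK hK' hy hy'
  obtain ⟨hu2, hug⟩ := hu
  choose g hg using hug
  have hw : WeakGrad Ω u g := weakGrad_of_hasWeakPartial hg
  have hui := (hu2.integrable_indicator hΩ).locallyIntegrable
  have hgi : ∀ i, LocallyIntegrable (Ω.indicator (g i)) := fun i =>
    ((hg i).2.1.integrable_indicator hΩ).locallyIntegrable
  have hw' : WeakGrad Ω (Ω.indicator u) fun i => Ω.indicator (g i) :=
    hw.congr (.of_forall fun x hx => (indicator_of_mem hx _).symm)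
      fun i => .of_forall fun x hx => (indicator_of_mem hx _).symm
  have hgK : ∀ K ∈ T, ∀ i, ∀ᵐ x, x ∈ interior K.carrier →
      Ω.indicator (g i) x = val (MvPolynomial.pderiv i (p K)) x := by
    intro K hK i
    have h1 := hw'.mono (hT.interior_carrier_subset hΩ hK)
    have h2 : WeakGrad (interior K.carrier) (val (p K)) fun i => Ω.indicator (g i) := by
      refine h1.congr ?_ fun i => .of_forall fun _ _ => rfl
      filter_upwards [hp K hK] with x hx hxK
      rw [indicator_of_mem (hT.interior_carrier_subset hΩ hK hxK), hx hxK]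
    exact h2.ae_eq isOpen_interior (weakGrad_val _ _) hgi (fun _ => locallyIntegrable_val _) i
  have hM : ∀ i, ∃ M : NNReal, ∀ᵐ x, x ∈ Ω → |Ω.indicator (g i) x| ≤ M := fun i =>
    hT.exists_ae_bound fun K hK => hgK K hK i
  choose M hM using hM
  obtain ⟨r, hr, hrΩ⟩ := Metric.isOpen_iff.1 hΩ.isOpen y hyΩ
  obtain ⟨f, hf, hfu⟩ := exists_lipschitzWith_of_weakGrad isOpen_ball (convex_ball y r) hui
    (M := max (M 0) (M 1)) (fun i => by
      filter_upwards [hM i] with x hx hxb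
      refine (hx (hrΩ hxb)).trans ?_
      fin_cases i
      · exact_mod_cast le_max_left _ _
      · exact_mod_cast le_max_right _ _) (hw'.mono hrΩ)
  have key : ∀ K ∈ T, y ∈ K.carrier → f y = val (p K) y := by
    intro K hK hyK
    refine eq_val_of_continuousAt hf.continuous.continuousAt hyK ?_
    have := eq_val_of_ae_eq (U := ball y r ∩ interior K.carrier) (isOpen_ball.inter isOpen_interior)
      hf.continuous.continuousOn (p := p K) (by
        filter_upwards [hfu, hp K hK] with x h1 h2 hx
        rw [← h1 hx.1, indicator_of_mem (hrΩ hx.1), h2 hx.2])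
    filter_upwards [ball_mem_nhds y hr] with x hx hxK using this x ⟨hx, hxK⟩
  intro K hK K' hK' hyK hyK'
  rw [← key K hK hyK, ← key K' hK' hyK']

/-- A piecewise polynomial, weakly curl-free field on a simply connected polygonal domain has a
continuous piecewise polynomial potential. -/
theorem IsRegularTriangulation.exists_potential (hT : IsRegularTriangulation Ω T)
    (hΩ : IsPolygonalDomain Ω) [SimplyConnectedSpace Ω] {m : ℕ} {P : Triangle → Fin 2 → Poly}
    (hP : ∀ K ∈ T, ∀ i, (P K i).totalDegree ≤ m) {g : Fin 2 → Plane → ℝ}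
    (hg : ∀ K ∈ T, ∀ i, ∀ᵐ x, x ∈ interior K.carrier → g i x = val (P K i) x)
    (hg2 : ∀ i, IsL2 Ω (g i)) (hcl : WeakClosed Ω g) :
    ∃ (F : Plane → ℝ) (q : Triangle → Poly), ContinuousOn F Ω ∧ IsL2 Ω F ∧
      (∀ i, HasWeakPartial Ω i F (g i)) ∧
      (∀ K ∈ T, (q K).totalDegree ≤ m + 1) ∧
      (∀ K ∈ T, ∀ i, MvPolynomial.pderiv i (q K) = P K i) ∧
      (∀ K ∈ T, ∀ x ∈ interior K.carrier, F x = val (q K) x) ∧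
      ∀ K ∈ T, ∀ K' ∈ T, ∀ y ∈ K.carrier, y ∈ K'.carrier → val (q K) y = val (q K') y := by
  have hgi : ∀ i, LocallyIntegrable (Ω.indicator (g i)) := fun i =>
    ((hg2 i).integrable_indicator hΩ).locallyIntegrable
  have hgK : ∀ K ∈ T, ∀ i, ∀ᵐ x, x ∈ interior K.carrier →
      Ω.indicator (g i) x = val (P K i) x := by
    intro K hK i
    filter_upwards [hg K hK i] with x hx hxK
    rw [indicator_of_mem (hT.interior_carrier_subset hΩ hK hxK), hx hxK]
  have hM : ∀ i, ∃ M : NNReal, ∀ᵐ x, x ∈ Ω → |Ω.indicator (g i) x| ≤ M := fun i =>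
    hT.exists_ae_bound fun K hK => hgK K hK i
  choose M hM using hM
  have hcl' : WeakClosed Ω fun i => Ω.indicator (g i) := by
    intro ψ hψ
    have e : ∀ i j, ∫ x, Ω.indicator (g i) x * partialDeriv j ψ x =
        ∫ x, g i x * partialDeriv j ψ x := by
      intro i j
      congr 1
      ext x
      by_cases hx : x ∈ Ω
      · rw [indicator_of_mem hx]
      · rw [hψ.partialDeriv_eq_zero j hx, mul_zero, mul_zero]
    rw [e, e]
    exact hcl ψ hψ
  obtain ⟨F, hF, hFw⟩ := exists_continuousOn_weakGrad hΩ.isOpen hgi (M := max (M 0) (M 1))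
    (fun i => by
      filter_upwards [hM i] with x hx hxΩ
      refine (hx hxΩ).trans ?_
      fin_cases i
      · exact_mod_cast le_max_left _ _
      · exact_mod_cast le_max_right _ _) hcl'
  have hq : ∀ K : Triangle, ∃ q : Poly, K ∈ T → q.totalDegree ≤ m + 1 ∧
      (∀ i, MvPolynomial.pderiv i q = P K i) ∧ ∀ x ∈ interior K.carrier, F x = val q x := by
    intro K
    by_cases hK : K ∈ T
    · have hsub := hT.interior_carrier_subset hΩ hK
      obtain ⟨q, hq⟩ := exists_eq_val_of_weakGrad isOpen_interior K.isPreconnected_interior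
        K.nonempty_interior (hF.mono hsub) (hFw.mono hsub)
        (fun ψ hψ => hcl' ψ ⟨hψ.1, hψ.2.1, hψ.2.2.trans hsub⟩) (hgK K hK) (hP K hK)
      exact ⟨q, fun _ => hq⟩
    · exact ⟨0, fun h => absurd h hK⟩
  choose q hq using hq
  have hF2 : IsL2 Ω F := hT.isL2 hΩ hF fun K hK => (hq K hK).2.2
  refine ⟨F, q, hF, hF2, fun i => ?_, fun K hK => (hq K hK).1, fun K hK => (hq K hK).2.1,
    fun K hK => (hq K hK).2.2, fun K hK K' hK' y hy hy' => ?_⟩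
  · refine HasWeakPartial.of_weakGrad (hFw.congr (.of_forall fun _ _ => rfl)
      fun i => .of_forall fun x hx => indicator_of_mem hx _) hF2 i (hg2 i)
  · refine hT.val_eq_of_mem hΩ (fun y hyΩ => ?_) hK hK' hy hy'
    have key : ∀ K ∈ T, y ∈ K.carrier → F y = val (q K) y := fun K hK hyK =>
      eq_val_of_continuousAt (hF.continuousAt (hΩ.isOpen.mem_nhds hyΩ)) hyK
        (.of_forall (hq K hK).2.2)
    intro K hK K' hK' hyK hyK'
    rw [← key K hK hyK, ← key K' hK' hyK']

end Continuity

/-! ### Polynomial pieces of the extended stress space -/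

/-- The value of a polynomial matrix field at a point. -/
noncomputable def matVal (E : Matrix (Fin 2) (Fin 2) Poly) (x : Plane) : Matrix (Fin 2) (Fin 2) ℝ :=
  Matrix.of fun i j => val (E i j) x

/-- The `i`-th barycentric coordinate as a polynomial. -/
noncomputable def baryPoly (K : Triangle) (i : Fin 3) : Poly :=
  MvPolynomial.C (K.bary i 0) + ∑ j, MvPolynomial.C (K.bary i (EuclideanSpace.single j 1) -
    K.bary i 0) * MvPolynomial.X j

theorem val_baryPoly (K : Triangle) (i : Fin 3) (x : Plane) :
    val (baryPoly K i) x = K.bary i x := by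
  have h : ∀ w, K.bary i w = (K.basis.coord i).linear w + K.bary i 0 := fun w => by
    have := (K.basis.coord i).map_vadd 0 w
    simpa [Triangle.bary] using this
  have hw : x = x 0 • EuclideanSpace.single 0 1 + x 1 • EuclideanSpace.single 1 1 := by
    ext i; fin_cases i <;> simp
  rw [baryPoly, val_add, val_C, Fin.sum_univ_two, val_add, val_mul, val_mul, val_C, val_C, val_X,
    val_X, h x, h (EuclideanSpace.single 0 1), h (EuclideanSpace.single 1 1)]
  conv_rhs => rw [hw]
  rw [map_add, map_smul, map_smul, smul_eq_mul, smul_eq_mul]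
  ring

theorem totalDegree_baryPoly_le (K : Triangle) (i : Fin 3) : (baryPoly K i).totalDegree ≤ 1 := by
  refine (MvPolynomial.totalDegree_add _ _).trans (max_le (by simp) ?_)
  refine MvPolynomial.totalDegree_finsetSum_le fun j _ => ?_
  refine (MvPolynomial.totalDegree_mul _ _).trans ?_
  rw [MvPolynomial.totalDegree_C, MvPolynomial.totalDegree_X]

/-- The composition of `lagrange k` with a polynomial. -/
noncomputable def lagrangePoly (k : ℕ) (p : Poly) : Poly :=
  ∏ j ∈ Finset.range k,
    (MvPolynomial.C ((k : ℝ) / (j + 1)) * p - MvPolynomial.C ((j : ℝ) / (j + 1)))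

theorem val_lagrangePoly (k : ℕ) (p : Poly) (x : Plane) :
    val (lagrangePoly k p) x = lagrange k (val p x) := by
  unfold lagrangePoly lagrange
  rw [val, map_prod]
  refine Finset.prod_congr rfl fun j _ => ?_
  rw [map_sub, map_mul, MvPolynomial.eval_C, MvPolynomial.eval_C, val]
  ring

theorem totalDegree_lagrangePoly_le (k : ℕ) {p : Poly} (hp : p.totalDegree ≤ 1) :
    (lagrangePoly k p).totalDegree ≤ k := by
  refine (MvPolynomial.totalDegree_finsetProd _ _).trans ?_
  refine (Finset.sum_le_card_nsmul _ _ 1 fun j _ => ?_).trans (by simp)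
  refine (MvPolynomial.totalDegree_sub _ _).trans (max_le ?_ (by simp))
  refine (MvPolynomial.totalDegree_mul _ _).trans ?_
  simpa using hp

theorem lagrange_zero {k : ℕ} (hk : 0 < k) : lagrange k 0 = 0 :=
  Finset.prod_eq_zero (Finset.mem_range.2 hk) (by simp)

theorem quad_add (u w : Plane) (A B : Matrix (Fin 2) (Fin 2) ℝ) :
    quad u (A + B) w = quad u A w + quad u B w := by
  simp [quad, mul_add, add_mul, Finset.sum_add_distrib]

theorem quad_smul (u w : Plane) (c : ℝ) (A : Matrix (Fin 2) (Fin 2) ℝ) :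
    quad u (c • A) w = c * quad u A w := by
  simp only [quad, Matrix.smul_apply, smul_eq_mul, Finset.mul_sum]
  exact Finset.sum_congr rfl fun i _ => Finset.sum_congr rfl fun j _ => by ring

theorem matVal_add (A B : Matrix (Fin 2) (Fin 2) Poly) (x : Plane) :
    matVal (A + B) x = matVal A x + matVal B x := by
  ext i j; exact val_add _ _ _

theorem matVal_zero (x : Plane) : matVal 0 x = 0 := by
  ext i j; simp [matVal, val]

theorem matVal_C_smul (c : ℝ) (A : Matrix (Fin 2) (Fin 2) Poly) (x : Plane) :
    matVal ((MvPolynomial.C c : Poly) • A) x = c • matVal A x := by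
  ext i j; simp [matVal, val]

theorem AgreeAt.comp {α β : Type*} {T : Set Triangle} {x : Plane} {C : Triangle → Prop}
    {F : Triangle → α} (h : AgreeAt T x C F) (f : α → β) : AgreeAt T x C fun K => f (F K) :=
  fun K hK K' hK' hx hx' hC hC' => congrArg f (h K hK K' hK' hx hx' hC hC')

theorem AgreeAt.congr {α : Type*} {T : Set Triangle} {x : Plane} {C : Triangle → Prop}
    {F G : Triangle → α} (h : AgreeAt T x C F) (hFG : ∀ K ∈ T, x ∈ K.verts → G K = F K) :
    AgreeAt T x C G :=
  fun K hK K' hK' hx hx' h1 h2 => by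
    rw [hFG K hK hx, hFG K' hK' hx', h K hK K' hK' hx hx' h1 h2]

theorem AgreeAt.add {α : Type*} [Add α] {T : Set Triangle} {x : Plane} {C : Triangle → Prop}
    {F G : Triangle → α} (h : AgreeAt T x C F) (h' : AgreeAt T x C G) :
    AgreeAt T x C fun K => F K + G K :=
  fun K hK K' hK' hx hx' h1 h2 => by
    simp only [h K hK K' hK' hx hx' h1 h2, h' K hK K' hK' hx hx' h1 h2]

/-- The polynomial matrix fields `E K` are the pieces of a field in the extended stress space: they
are symmetric, of degree at most `k`, continuous at the initial and at the boundary vertices, and at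
the new internal vertices only the pure tangential component may jump across the bisected edge. -/
structure IsStressPieces (Ω : Set Plane) (k : ℕ) (T₀ T : Set Triangle)
    (edge : Plane → Plane × Plane) (τ : MatrixField)
    (E : Triangle → Matrix (Fin 2) (Fin 2) Poly) : Prop where
  isSymm : ∀ K ∈ T, (E K).IsSymm
  degree : ∀ K ∈ T, ∀ i j, (E K i j).totalDegree ≤ k
  ae_eq : ∀ K ∈ T, ∀ᵐ x, x ∈ interior K.carrier → τ x = matVal (E K) x
  continuous : ∀ x ∈ vertices T, x ∈ vertices T₀ ∨ x ∉ Ω →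
    AgreeAt T x (fun _ => True) fun K => matVal (E K) x
  tangential_normal : ∀ x ∈ newInternalVertices Ω T₀ T, AgreeAt T x (fun _ => True)
    fun K => quad (tangent (edge x)) (matVal (E K) x) (normal (edge x))
  normal_normal : ∀ x ∈ newInternalVertices Ω T₀ T, AgreeAt T x (fun _ => True)
    fun K => quad (normal (edge x)) (matVal (E K) x) (normal (edge x))
  tangential_pos : ∀ x ∈ newInternalVertices Ω T₀ T, AgreeAt T x (OnSide x (normal (edge x)))
    fun K => quad (tangent (edge x)) (matVal (E K) x) (tangent (edge x))
  tangential_neg : ∀ x ∈ newInternalVertices Ω T₀ T, AgreeAt T x (OnSide x (-normal (edge x)))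
    fun K => quad (tangent (edge x)) (matVal (E K) x) (tangent (edge x))

section Stress

variable {Ω : Set Plane} {k : ℕ} {T₀ T : Set Triangle} {edge : Plane → Plane × Plane}

theorem IsStressPieces.add {τ τ' : MatrixField} {E E' : Triangle → Matrix (Fin 2) (Fin 2) Poly}
    (h : IsStressPieces Ω k T₀ T edge τ E) (h' : IsStressPieces Ω k T₀ T edge τ' E') :
    IsStressPieces Ω k T₀ T edge (τ + τ') (E + E') where
  isSymm K hK := (h.isSymm K hK).add (h'.isSymm K hK)
  degree K hK i j :=
    (MvPolynomial.totalDegree_add _ _).trans (max_le (h.degree K hK i j) (h'.degree K hK i j))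
  ae_eq K hK := by
    filter_upwards [h.ae_eq K hK, h'.ae_eq K hK] with x hx hx' hxK
    rw [Pi.add_apply, Pi.add_apply, matVal_add, hx hxK, hx' hxK]
  continuous x hx hx' := by
    simpa only [Pi.add_apply, matVal_add] using (h.continuous x hx hx').add (h'.continuous x hx hx')
  tangential_normal x hx := by
    simpa only [Pi.add_apply, matVal_add, quad_add] using
      (h.tangential_normal x hx).add (h'.tangential_normal x hx)
  normal_normal x hx := by
    simpa only [Pi.add_apply, matVal_add, quad_add] using
      (h.normal_normal x hx).add (h'.normal_normal x hx)
  tangential_pos x hx := by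
    simpa only [Pi.add_apply, matVal_add, quad_add] using
      (h.tangential_pos x hx).add (h'.tangential_pos x hx)
  tangential_neg x hx := by
    simpa only [Pi.add_apply, matVal_add, quad_add] using
      (h.tangential_neg x hx).add (h'.tangential_neg x hx)

theorem IsStressPieces.smul (c : ℝ) {τ : MatrixField} {E : Triangle → Matrix (Fin 2) (Fin 2) Poly}
    (h : IsStressPieces Ω k T₀ T edge τ E) :
    IsStressPieces Ω k T₀ T edge (c • τ) (fun K => (MvPolynomial.C c : Poly) • E K) where
  isSymm K hK := (h.isSymm K hK).smul _
  degree K hK i j := by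
    refine (MvPolynomial.totalDegree_mul _ _).trans ?_
    simpa using h.degree K hK i j
  ae_eq K hK := by
    filter_upwards [h.ae_eq K hK] with x hx hxK
    rw [Pi.smul_apply, matVal_C_smul, hx hxK]
  continuous x hx hx' := by
    simpa only [matVal_C_smul] using (h.continuous x hx hx').comp (c • ·)
  tangential_normal x hx := by
    simpa only [matVal_C_smul, quad_smul] using (h.tangential_normal x hx).comp (c * ·)
  normal_normal x hx := by
    simpa only [matVal_C_smul, quad_smul] using (h.normal_normal x hx).comp (c * ·)
  tangential_pos x hx := by
    simpa only [matVal_C_smul, quad_smul] using (h.tangential_pos x hx).comp (c * ·)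
  tangential_neg x hx := by
    simpa only [matVal_C_smul, quad_smul] using (h.tangential_neg x hx).comp (c * ·)

theorem IsStressPieces.zero :
    IsStressPieces Ω k T₀ T edge 0 (fun _ => 0) where
  isSymm _ _ := Matrix.isSymm_zero
  degree _ _ _ _ := by simp
  ae_eq _ _ := .of_forall fun x _ => (matVal_zero x).symm
  continuous _ _ _ _ _ _ _ _ _ _ _ := rfl
  tangential_normal _ _ _ _ _ _ _ _ _ _ := rfl
  normal_normal _ _ _ _ _ _ _ _ _ _ := rfl
  tangential_pos _ _ _ _ _ _ _ _ _ _ := rfl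
  tangential_neg _ _ _ _ _ _ _ _ _ _ := rfl

theorem dyad_isSymm (t : Plane) : (dyad t).IsSymm := by
  ext i j; simp [dyad, mul_comm]

/-- The polynomial matrix field `p · A`. -/
noncomputable def polySmul (p : Poly) (A : Matrix (Fin 2) (Fin 2) ℝ) :
    Matrix (Fin 2) (Fin 2) Poly :=
  Matrix.of fun i j => p * MvPolynomial.C (A i j)

theorem matVal_polySmul (p : Poly) (A : Matrix (Fin 2) (Fin 2) ℝ) (x : Plane) :
    matVal (polySmul p A) x = val p x • A := by
  ext i j; simp [matVal, polySmul, val]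

theorem polySmul_isSymm (p : Poly) {A : Matrix (Fin 2) (Fin 2) ℝ} (hA : A.IsSymm) :
    (polySmul p A).IsSymm := by
  ext i j; simp [polySmul, hA.apply i j]

theorem totalDegree_polySmul_le {p : Poly} {k : ℕ} (hp : p.totalDegree ≤ k)
    (A : Matrix (Fin 2) (Fin 2) ℝ) (i j : Fin 2) : (polySmul p A i j).totalDegree ≤ k := by
  refine (MvPolynomial.totalDegree_mul _ _).trans ?_
  simpa using hp

/-- A bubble field is polynomial and vanishes at the vertices. -/
theorem IsBubbleOn.exists_poly {K : Triangle} {τ : MatrixField} (hk : 2 ≤ k)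
    (h : IsBubbleOn k K τ) : ∃ Q : Matrix (Fin 2) (Fin 2) Poly, Q.IsSymm ∧
      (∀ i j, (Q i j).totalDegree ≤ k) ∧
      (∀ᵐ x, x ∈ interior K.carrier → τ x = matVal Q x) ∧ ∀ x ∈ K.verts, matVal Q x = 0 := by
  obtain ⟨q, hq, hτ⟩ := h
  have hval : ∀ x, matVal (∑ i, ∑ j ∈ Finset.Ioi i, polySmul (baryPoly K i * baryPoly K j * q i j)
      (dyad (K.points j - K.points i))) x = ∑ i, ∑ j ∈ Finset.Ioi i,
        (K.bary i x * K.bary j x * val (q i j) x) • dyad (K.points j - K.points i) := by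
    intro x
    let f : Matrix (Fin 2) (Fin 2) Poly →+ Matrix (Fin 2) (Fin 2) ℝ :=
      ⟨⟨fun A => matVal A x, matVal_zero x⟩, fun A B => matVal_add A B x⟩
    have hf : ∀ A, matVal A x = f A := fun _ => rfl
    rw [hf, map_sum]
    refine Finset.sum_congr rfl fun i _ => ?_
    rw [map_sum]
    refine Finset.sum_congr rfl fun j _ => ?_
    rw [← hf, matVal_polySmul, val_mul, val_mul, val_baryPoly, val_baryPoly]
  refine ⟨∑ i, ∑ j ∈ Finset.Ioi i, polySmul (baryPoly K i * baryPoly K j * q i j)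
    (dyad (K.points j - K.points i)), ?_, fun a b => ?_, ?_, ?_⟩
  · rw [Matrix.IsSymm, Matrix.transpose_sum]
    refine Finset.sum_congr rfl fun i _ => ?_
    rw [Matrix.transpose_sum]
    exact Finset.sum_congr rfl fun j _ => polySmul_isSymm _ (dyad_isSymm _)
  · rw [Matrix.sum_apply]
    refine MvPolynomial.totalDegree_finsetSum_le fun i _ => ?_
    rw [Matrix.sum_apply]
    refine MvPolynomial.totalDegree_finsetSum_le fun j _ => ?_
    refine totalDegree_polySmul_le ?_ _ a b
    have h1 := totalDegree_baryPoly_le K i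
    have h2 := totalDegree_baryPoly_le K j
    have h3 := hq i j
    have h4 := MvPolynomial.totalDegree_mul (baryPoly K i) (baryPoly K j)
    have h5 := MvPolynomial.totalDegree_mul (baryPoly K i * baryPoly K j) (q i j)
    omega
  · filter_upwards [ae_interior_of_ae_restrict hτ] with x hx hxK
    rw [hval, hx hxK]
  · rintro _ ⟨l, rfl⟩
    rw [hval]
    refine Finset.sum_eq_zero fun i _ => Finset.sum_eq_zero fun j hj => ?_
    have hij : i ≠ j := (Finset.mem_Ioi.1 hj).ne
    have : K.bary i (K.points l) * K.bary j (K.points l) = 0 := by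
      rw [K.bary_vert, K.bary_vert]
      by_cases hil : i = l
      · have : j ≠ l := fun h => hij (hil.trans h.symm)
        simp [this]
      · simp [hil]
    rw [this, zero_mul, zero_smul]

/-- Fields in `Σ(T)` are continuous at all vertices. -/
theorem exists_isStressPieces_of_mem_stressSpace (hΩ : IsPolygonalDomain Ω)
    (hT : IsRegularTriangulation Ω T) (hk : 2 ≤ k) {σ : MatrixField} (hσ : σ ∈ stressSpace Ω k T) :
    ∃ E, IsStressPieces Ω k T₀ T edge σ E := by
  obtain ⟨-, σc, σb, hsum, hc, hK⟩ := hσ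
  have hP : ∀ K : Triangle, ∃ P : Matrix (Fin 2) (Fin 2) Poly, K ∈ T → P.IsSymm ∧
      (∀ i j, (P i j).totalDegree ≤ k) ∧ ∀ᵐ x, x ∈ interior K.carrier → σc x = matVal P x := by
    intro K
    by_cases h : K ∈ T
    · obtain ⟨P, h1, h2, h3⟩ := (hK K h).1
      exact ⟨P, fun _ => ⟨h1, h2, ae_interior_of_ae_restrict h3⟩⟩
    · exact ⟨0, fun h' => absurd h' h⟩
  have hQ : ∀ K : Triangle, ∃ Q : Matrix (Fin 2) (Fin 2) Poly, K ∈ T → Q.IsSymm ∧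
      (∀ i j, (Q i j).totalDegree ≤ k) ∧
      (∀ᵐ x, x ∈ interior K.carrier → σb x = matVal Q x) ∧ ∀ x ∈ K.verts, matVal Q x = 0 := by
    intro K
    by_cases h : K ∈ T
    · obtain ⟨Q, hQ⟩ := (hK K h).2.exists_poly hk
      exact ⟨Q, fun _ => hQ⟩
    · exact ⟨0, fun h' => absurd h' h⟩
  choose P hP using hP
  choose Q hQ using hQ
  have hag : ∀ x C, AgreeAt T x C fun K => matVal (P K + Q K) x := by
    intro x C K hK K' hK' hx hx' _ _
    simp only
    rw [matVal_add, matVal_add, (hQ K hK).2.2.2 x hx, (hQ K' hK').2.2.2 x hx', add_zero, add_zero]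
    ext i j
    refine hT.val_eq_of_mem_H1 hΩ (hc.2 i j) (p := fun K => P K i j) (fun L hL => ?_) hK hK'
      (K.vert_mem_carrier hx) (K'.vert_mem_carrier hx')
    filter_upwards [(hP L hL).2.2] with z hz hzL
    rw [hz hzL]; rfl
  refine ⟨fun K => P K + Q K, fun K hK => (hP K hK).1.add (hQ K hK).1, fun K hK i j => ?_,
    fun K hK => ?_, fun x _ _ => hag x _, fun x _ => (hag x _).comp (quad _ · _),
    fun x _ => (hag x _).comp (quad _ · _), fun x _ => (hag x _).comp (quad _ · _),
    fun x _ => (hag x _).comp (quad _ · _)⟩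
  · exact (MvPolynomial.totalDegree_add _ _).trans
      (max_le ((hP K hK).2.1 i j) ((hQ K hK).2.1 i j))
  · filter_upwards [(hP K hK).2.2, (hQ K hK).2.2.1,
      (ae_restrict_iff' hΩ.isOpen.measurableSet).1 hsum] with x h1 h2 h3 hx
    rw [h3 (hT.interior_carrier_subset hΩ hK hx), h1 hx, h2 hx, matVal_add]

theorem quad_dyad (u t w : Plane) :
    quad u (dyad t) w = (u 0 * t 0 + u 1 * t 1) * (t 0 * w 0 + t 1 * w 1) := by
  simp [quad, dyad, Fin.sum_univ_two]; ring

theorem nodalBasis_eq (hT : IsRegularTriangulation Ω T) {K : Triangle} (hK : K ∈ T) {x y : Plane}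
    (hy : y ∈ interior K.carrier) {i : Fin 3} (hi : K.points i = x) :
    nodalBasis k T x y = lagrange k (K.bary i y) := by
  have h : ∃ Ki : Triangle × Fin 3, Ki.1 ∈ T ∧ Ki.1.points Ki.2 = x ∧ y ∈ Ki.1.carrier :=
    ⟨(K, i), hK, hi, interior_subset hy⟩
  rw [nodalBasis, dif_pos h]
  have h1 : h.choose.1 = K := hT.eq_of_mem_interior hK h.choose_spec.1 hy h.choose_spec.2.2
  have h2 : h.choose.2 = i := by
    have h3 := h.choose_spec.2.1
    rw [h1] at h3
    exact K.independent.injective (h3.trans hi.symm)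
  rw [h1, h2]

theorem nodalBasis_eq_zero (hT : IsRegularTriangulation Ω T) {K : Triangle} (hK : K ∈ T)
    {x y : Plane} (hy : y ∈ interior K.carrier) (hx : x ∉ K.verts) : nodalBasis k T x y = 0 := by
  rw [nodalBasis, dif_neg]
  rintro ⟨⟨K', i⟩, hK', hi, hyK'⟩
  obtain rfl := hT.eq_of_mem_interior hK hK' hy hyK'
  exact hx ⟨i, hi⟩

open Classical in
/-- The polynomial pieces of the field equal to `φ_x t tᵀ` on the side `n` of `x` and to `0`
elsewhere: nonzero only on the triangles on this side that have `x` as a vertex. -/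
noncomputable def splitPieces (k : ℕ) (x t n : Plane) (K : Triangle) :
    Matrix (Fin 2) (Fin 2) Poly :=
  if OnSide x n K then
    if h : ∃ i, K.points i = x then polySmul (lagrangePoly k (baryPoly K h.choose)) (dyad t) else 0
  else 0

/-- The split basis fields satisfy the vertex conditions: they vanish at all vertices but `x₀`, and
at `x₀` their values are multiples of `t tᵀ`, where `t` is orthogonal to `n`. -/
theorem isStressPieces_splitBasis (hT : IsRegularTriangulation Ω T) (hk : 0 < k) {x₀ : Plane}
    (hx₀ : x₀ ∈ newInternalVertices Ω T₀ T) {n : Plane}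
    (hn : n = normal (edge x₀) ∨ n = -normal (edge x₀)) :
    IsStressPieces Ω k T₀ T edge (splitBasis k T x₀ (tangent (edge x₀)) n)
      (splitPieces k x₀ (tangent (edge x₀)) n) := by
  classical
  set t := tangent (edge x₀) with ht
  have hperp : t 0 * normal (edge x₀) 0 + t 1 * normal (edge x₀) 1 = 0 := by
    simp [normal, ht]; ring
  -- the pieces vanish at the other vertices, and at `x₀` they are constant on each side
  have hother : ∀ x K, x ≠ x₀ → x ∈ K.verts → matVal (splitPieces k x₀ t n K) x = 0 := by
    rintro _ K hx ⟨j, rfl⟩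
    unfold splitPieces
    split_ifs with h1 h2
    · have hne : h2.choose ≠ j := by
        intro h
        exact hx (h ▸ h2.choose_spec)
      rw [matVal_polySmul, val_lagrangePoly, val_baryPoly, K.bary_vert, if_neg hne,
        lagrange_zero hk, zero_smul]
    · exact matVal_zero _
    · exact matVal_zero _
  have hself : ∀ K, x₀ ∈ K.verts → matVal (splitPieces k x₀ t n K) x₀ =
      (if OnSide x₀ n K then lagrange k 1 else 0) • dyad t := by
    intro K hx
    have h2 : ∃ i, K.points i = x₀ := hx
    unfold splitPieces
    rw [dif_pos h2]
    split_ifs with h1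
    · have h3 : K.bary h2.choose x₀ = 1 :=
        (congrArg (K.bary h2.choose) h2.choose_spec).symm.trans (by rw [K.bary_vert]; simp)
      rw [matVal_polySmul, val_lagrangePoly, val_baryPoly, h3]
    · rw [matVal_zero, zero_smul]
  have hopp : ∀ m K, OnSide x₀ m K → ¬ OnSide x₀ (-m) K := by
    rintro m K ⟨-, h⟩ ⟨-, h'⟩
    rw [inner_neg_right] at h'
    linarith
  have hside : ∀ m, (m = normal (edge x₀) ∨ m = -normal (edge x₀)) → ∀ K K', OnSide x₀ m K →
      OnSide x₀ m K' → (OnSide x₀ n K ↔ OnSide x₀ n K') := by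
    intro m hm K K' h h'
    have hnm : n = m ∨ n = -m := by
      rcases hn with rfl | rfl <;> rcases hm with rfl | rfl <;> simp
    rcases hnm with rfl | rfl
    · exact iff_of_true h h'
    · exact iff_of_false (hopp _ _ h) (hopp _ _ h')
  have hag : ∀ x C u w, (x = x₀ → ∀ K K', C K → C K' →
      quad u ((if OnSide x₀ n K then lagrange k 1 else 0) • dyad t) w =
      quad u ((if OnSide x₀ n K' then lagrange k 1 else 0) • dyad t) w) →
      AgreeAt T x C fun K => quad u (matVal (splitPieces k x₀ t n K) x) w := by
    intro x C u w h K hK K' hK' hx hx' hC hC'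
    simp only
    by_cases hxx : x = x₀
    · subst hxx
      rw [hself K hx, hself K' hx']
      exact h rfl K K' hC hC'
    · rw [hother x K hxx hx, hother x K' hxx hx']
  refine ⟨fun K _ => ?_, fun K _ i j => ?_, fun K hK => .of_forall fun y hy => ?_,
    fun x _ hx' => ?_, fun x _ => hag x _ _ _ ?_, fun x _ => hag x _ _ _ ?_,
    fun x _ => hag x _ _ _ ?_, fun x _ => hag x _ _ _ ?_⟩
  · unfold splitPieces
    split_ifs
    · exact polySmul_isSymm _ (dyad_isSymm t)
    · exact Matrix.isSymm_zero
    · exact Matrix.isSymm_zero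
  · unfold splitPieces
    split_ifs
    · exact totalDegree_polySmul_le
        (totalDegree_lagrangePoly_le k (totalDegree_baryPoly_le _ _)) _ i j
    · simp
    · simp
  · have hpatch : y ∈ patch T x₀ n ↔ OnSide x₀ n K := by
      simp only [patch, mem_iUnion, mem_ofPred_eq, exists_prop]
      constructor
      · rintro ⟨K', ⟨hK', hs⟩, hyK'⟩
        rwa [hT.eq_of_mem_interior hK hK' hy hyK'] at hs
      · exact fun hs => ⟨K, ⟨hK, hs⟩, interior_subset hy⟩
    unfold splitPieces splitBasis
    split_ifs with h1 h2
    · rw [indicator_of_mem (hpatch.2 h1), nodalBasis_eq hT hK hy h2.choose_spec, matVal_polySmul,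
        val_lagrangePoly, val_baryPoly]
    · rw [indicator_of_mem (hpatch.2 h1), nodalBasis_eq_zero hT hK hy (fun h => h2 h), zero_smul,
        matVal_zero]
    · rw [indicator_of_notMem (fun h => h1 (hpatch.1 h)), matVal_zero]
  · have hne : x ≠ x₀ := by
      rintro rfl
      rcases hx' with h | h
      · exact hx₀.2 h
      · exact h hx₀.1.2
    intro K hK K' hK' h h' _ _
    simp only
    rw [hother x K hne h, hother x K' hne h']
  · rintro rfl K K' _ _
    rw [quad_smul, quad_smul, quad_dyad, hperp]; simp
  · rintro rfl K K' _ _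
    rw [quad_smul, quad_smul, quad_dyad, hperp]; simp
  · rintro rfl K K' h h'
    simp only [hside _ (.inl rfl) K K' h h']
  · rintro rfl K K' h h'
    simp only [hside _ (.inr rfl) K K' h h']

/-- Every field in the extended stress space is piecewise polynomial with the expected
continuity. -/
theorem exists_isStressPieces (hΩ : IsPolygonalDomain Ω)
    (hT : IsRegularTriangulation Ω T) (hk : 2 ≤ k) {τ : MatrixField}
    (hτ : τ ∈ extendedStressSpace Ω k T₀ T edge) : ∃ E, IsStressPieces Ω k T₀ T edge τ E := by
  obtain ⟨σ, hσ, η, hη, rfl⟩ := hτ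
  obtain ⟨E, hE⟩ := exists_isStressPieces_of_mem_stressSpace (T₀ := T₀) (edge := edge) hΩ hT hk hσ
  obtain ⟨E', hE'⟩ : ∃ E, IsStressPieces Ω k T₀ T edge η E := by
    refine Submodule.span_induction ?_ ⟨_, IsStressPieces.zero⟩ ?_ ?_ hη
    · rintro _ ⟨x, hx, rfl | rfl⟩
      · exact ⟨_, isStressPieces_splitBasis hT (by omega) hx (.inl rfl)⟩
      · exact ⟨_, isStressPieces_splitBasis hT (by omega) hx (.inr rfl)⟩
    · rintro _ _ _ _ ⟨E, hE⟩ ⟨E', hE'⟩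
      exact ⟨_, hE.add hE'⟩
    · rintro c _ _ ⟨E, hE⟩
      exact ⟨_, hE.smul c⟩
  exact ⟨_, hE.add hE'⟩

end Stress

/-! ### The discrete Helmholtz decomposition -/

/-- The Hessian of `φ` in terms of `CurlCurl φ`: the adjugate, which for symmetric matrices is the
conjugate by the rotation by a right angle. -/
def rotate (A : Matrix (Fin 2) (Fin 2) ℝ) : Matrix (Fin 2) (Fin 2) ℝ :=
  !![A 1 1, -A 0 1; -A 1 0, A 0 0]

theorem hess_eq_rotate {p q₀ q₁ : Poly} {E : Matrix (Fin 2) (Fin 2) Poly}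
    (hp : ∀ i, MvPolynomial.pderiv i p = ![q₁, -q₀] i)
    (h₀ : ∀ i, MvPolynomial.pderiv i q₀ = ![E 0 1, -E 0 0] i)
    (h₁ : ∀ i, MvPolynomial.pderiv i q₁ = ![E 1 1, -E 1 0] i) (x : Plane) :
    hess p x = rotate (matVal E x) := by
  ext i j
  fin_cases i <;> fin_cases j <;> simp [hess, rotate, matVal, hp, h₀, h₁, val_neg]

theorem quad_normal_rotate_tangent (e : Plane × Plane) {A : Matrix (Fin 2) (Fin 2) ℝ}
    (hA : A.IsSymm) :
    quad (normal e) (rotate A) (tangent e) = -quad (tangent e) A (normal e) := by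
  have := hA.apply 0 1
  simp [quad, rotate, normal, Fin.sum_univ_two, this]

theorem quad_tangent_rotate_tangent (e : Plane × Plane) (A : Matrix (Fin 2) (Fin 2) ℝ) :
    quad (tangent e) (rotate A) (tangent e) = quad (normal e) A (normal e) := by
  simp [quad, rotate, normal, Fin.sum_univ_two]
  ring

theorem quad_normal_rotate_normal (e : Plane × Plane) (A : Matrix (Fin 2) (Fin 2) ℝ) :
    quad (normal e) (rotate A) (normal e) = quad (tangent e) A (tangent e) := by
  simp [quad, rotate, normal, Fin.sum_univ_two]
  ring

theorem matVal_isSymm {E : Matrix (Fin 2) (Fin 2) Poly} (hE : E.IsSymm) (x : Plane) :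
    (matVal E x).IsSymm := by
  ext i j; simp [matVal, hE.apply i j]

/-- The rows of a divergence-free matrix field, rotated by a right angle, are weakly curl-free. -/
theorem weakClosed_of_hasWeakDiv {Ω : Set Plane} {τ : MatrixField} (h : HasWeakDiv Ω τ 0)
    (hΩ : IsPolygonalDomain Ω) (i : Fin 2) :
    WeakClosed Ω ![fun x => τ x i 1, fun x => -τ x i 0] := by
  intro ψ hψ
  have h0 := h.2.2 i ψ hψ
  have hint : ∀ j, Integrable fun x => Ω.indicator (fun x => τ x i j) x * partialDeriv j ψ x :=
    fun j => integrable_mul_of_hasCompactSupport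
      ((h.1 i j).integrable_indicator hΩ).locallyIntegrable
      (hψ.continuous_partialDeriv j) (hψ.hasCompactSupport_partialDeriv j)
  have he : ∀ j, (fun x => Ω.indicator (fun x => τ x i j) x * partialDeriv j ψ x) =
      fun x => τ x i j * partialDeriv j ψ x := by
    intro j
    ext x
    by_cases hx : x ∈ Ω
    · rw [indicator_of_mem hx]
    · rw [hψ.partialDeriv_eq_zero j hx, mul_zero, mul_zero]
  simp_rw [he] at hint
  have hset : ∫ x in Ω, ∑ j, τ x i j * partialDeriv j ψ x =
      ∫ x, ∑ j, τ x i j * partialDeriv j ψ x :=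
    setIntegral_eq_integral_of_forall_compl_eq_zero fun x hx =>
      Finset.sum_eq_zero fun j _ => by rw [hψ.partialDeriv_eq_zero j hx, mul_zero]
  rw [hset, integral_finsetSum _ (fun j _ => hint j), Fin.sum_univ_two] at h0
  simp only [Pi.zero_apply, zero_mul, integral_zero, neg_zero] at h0
  simp only [Matrix.cons_val_zero, Matrix.cons_val_one, neg_mul, integral_neg]
  linarith

end Helmholtz

open Helmholtz MeasureTheory in
theorem mainTheorem5 (Ω : Set Helmholtz.Plane) (hΩ : Helmholtz.IsPolygonalDomain Ω)
    (hsc : SimplyConnectedSpace Ω) (T₀ That : Set Helmholtz.Triangle)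
    (hT₀ : Helmholtz.IsRegularTriangulation Ω T₀) (hThat : That ∈ Helmholtz.admissible Ω T₀)
    (edge : Helmholtz.Plane → Helmholtz.Plane × Helmholtz.Plane)
    (hedge : Helmholtz.IsEdgeChoice Ω T₀ That edge) (k : ℕ) (hk : 3 ≤ k)
    (τ : Helmholtz.MatrixField) (hτ : τ ∈ Helmholtz.extendedStressSpace Ω k T₀ That edge)
    (hdiv : Helmholtz.HasWeakDiv Ω τ 0) :
    ∃ φ ∈ Helmholtz.argyrisSpace Ω (k + 2) T₀ That edge, Helmholtz.IsCurlCurl Ω φ τ := by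
  have hT := hThat.2
  obtain ⟨E, hE⟩ := exists_isStressPieces hΩ hT (by omega) hτ
  have hτE : ∀ K ∈ That, ∀ i j, ∀ᵐ x, x ∈ interior K.carrier → τ x i j = val (E K i j) x := by
    intro K hK i j
    filter_upwards [hE.ae_eq K hK] with x hx hxK
    rw [hx hxK]; rfl
  -- the rows of `τ` are the `Curl`s of the components of a vector field `v`
  have hrow : ∀ i, ∃ (F : Plane → ℝ) (q : Triangle → Poly), ContinuousOn F Ω ∧ IsL2 Ω F ∧
      (∀ j, HasWeakPartial Ω j F (![fun x => τ x i 1, fun x => -τ x i 0] j)) ∧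
      (∀ K ∈ That, (q K).totalDegree ≤ k + 1) ∧
      (∀ K ∈ That, ∀ j, MvPolynomial.pderiv j (q K) = ![E K i 1, -E K i 0] j) ∧
      (∀ K ∈ That, ∀ x ∈ interior K.carrier, F x = val (q K) x) ∧
      ∀ K ∈ That, ∀ K' ∈ That, ∀ y ∈ K.carrier, y ∈ K'.carrier → val (q K) y = val (q K') y := by
    intro i
    refine hT.exists_potential hΩ (P := fun K => ![E K i 1, -E K i 0]) (fun K hK j => ?_)
      (fun K hK j => ?_) (fun j => ?_) (weakClosed_of_hasWeakDiv hdiv hΩ i)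
    · fin_cases j
      · exact hE.degree K hK i 1
      · exact (MvPolynomial.totalDegree_neg _).trans_le (hE.degree K hK i 0)
    · fin_cases j
      · exact hτE K hK i 1
      · filter_upwards [hτE K hK i 0] with x hx hxK
        exact (congrArg Neg.neg (hx hxK)).trans (val_neg _ _).symm
    · fin_cases j
      · exact hdiv.1 i 1
      · exact (hdiv.1 i 0).neg
  choose v q hvc hv2 hvw hqd hqp hvq hqq using hrow
  -- the symmetry of `τ` makes `v` divergence-free
  have hsymm : ∀ᵐ x, x ∈ Ω → τ x 0 1 = τ x 1 0 := by
    filter_upwards [hT.ae_exists_interior, (ae_ball_iff hT.finite.countable).2 hE.ae_eq]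
      with x hx hx' hxΩ
    obtain ⟨K, hK, hxK⟩ := hx hxΩ
    rw [hx' K hK hxK]
    exact (matVal_isSymm (hE.isSymm K hK) x).apply 1 0
  have hcl : WeakClosed Ω ![v 1, fun x => -v 0 x] := by
    intro ψ hψ
    have h0 := weakGrad_of_hasWeakPartial (hvw 0) 0 ψ hψ
    have h1 := weakGrad_of_hasWeakPartial (hvw 1) 1 ψ hψ
    simp only [Matrix.cons_val_zero, Matrix.cons_val_one, neg_mul, integral_neg, neg_neg]
      at h0 h1 ⊢
    rw [h0, h1, neg_neg]
    refine integral_congr_ae ?_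
    filter_upwards [hsymm] with x hx
    by_cases hxΩ : x ∈ Ω
    · simp only [hx hxΩ]
    · simp only [hψ.eq_zero hxΩ, mul_zero]
  obtain ⟨φ, p, -, hφ2, hφw, hpd, hpp, hφp, hpq⟩ := hT.exists_potential hΩ (m := k + 1)
    (P := fun K => ![q 1 K, -q 0 K]) (g := ![v 1, fun x => -v 0 x])
    (fun K hK j => by
      fin_cases j
      · exact hqd 1 K hK
      · exact (MvPolynomial.totalDegree_neg _).trans_le (hqd 0 K hK))
    (fun K hK j => .of_forall fun x hx => by
      fin_cases j
      · exact hvq 1 K hK x hx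
      · exact (congrArg Neg.neg (hvq 0 K hK x hx)).trans (val_neg _ _).symm)
    (fun j => by
      fin_cases j
      · exact hv2 1
      · exact (hv2 0).neg) hcl
  have hgrad : ∀ K ∈ That, ∀ K' ∈ That, ∀ y ∈ K.carrier, y ∈ K'.carrier → ∀ i,
      val (MvPolynomial.pderiv i (p K)) y = val (MvPolynomial.pderiv i (p K')) y := by
    intro K hK K' hK' y hy hy' i
    rw [hpp K hK, hpp K' hK']
    fin_cases i
    · exact hqq 1 K hK K' hK' y hy hy'
    · show val (-q 0 K) y = val (-q 0 K') y
      rw [val_neg, val_neg, hqq 0 K hK K' hK' y hy hy']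
  -- the conditions on the Hessian at the vertices become those on the pieces of `τ`
  have hhess : ∀ K ∈ That, ∀ x, hess (p K) x = rotate (matVal (E K) x) := fun K hK x =>
    hess_eq_rotate (hpp K hK) (hqp 0 K hK) (hqp 1 K hK) x
  refine ⟨φ, ⟨hφ2, p, ⟨fun K hK => ⟨hpd K hK, ae_restrict_of_interior (hφp K hK)⟩,
    fun x _ K hK K' hK' hx hx' _ _ =>
      hpq K hK K' hK' x (K.vert_mem_carrier hx) (K'.vert_mem_carrier hx'),
    fun x _ i K hK K' hK' hx hx' _ _ =>
      hgrad K hK K' hK' x (K.vert_mem_carrier hx) (K'.vert_mem_carrier hx') i,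
    fun K hK K' hK' _ a ha b hb _ y hy i => hgrad K hK K' hK' y
      (K.convex_carrier.segment_subset (K.vert_mem_carrier ha.1) (K.vert_mem_carrier hb.1) hy)
      (K'.convex_carrier.segment_subset (K'.vert_mem_carrier ha.2) (K'.vert_mem_carrier hb.2) hy) i,
    fun x hx hx' => ?_, fun x hx => ⟨?_, ?_, ?_, ?_⟩⟩⟩, fun x i => v i x, ?_, fun i => ?_⟩
  · exact ((hE.continuous x hx hx').comp rotate).congr fun K hK _ => hhess K hK x
  · exact ((hE.tangential_normal x hx).comp Neg.neg).congr fun K hK _ => by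
      rw [hhess K hK, quad_normal_rotate_tangent _ (matVal_isSymm (hE.isSymm K hK) x)]
  · exact (hE.normal_normal x hx).congr fun K hK _ => by
      rw [hhess K hK, quad_tangent_rotate_tangent]
  · exact (hE.tangential_pos x hx).congr fun K hK _ => by
      rw [hhess K hK, quad_normal_rotate_normal]
  · exact (hE.tangential_neg x hx).congr fun K hK _ => by
      rw [hhess K hK, quad_normal_rotate_normal]
  · exact ⟨hφw 1, hφw 0⟩
  · exact ⟨hvw i 1, hvw i 0⟩
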